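/- Let $V_n=\mathbb F_2^n$. For a Boolean function $f\colon V_n\to\mathbb F_2$ put $\hat f(\lambda)=\sum_{x\in V_n}(-1)^{f(x)+\langle\lambda,x\rangle}$, $\lambda\in V_n$; the vector $(\hat f(\lambda))_{\lambda\in V_n}$ is called the spectral sequence of $f$. Let $\mathcal B_{2n}$ be the set of bent functions of $2n$ variables, that is, of the $f\colon V_{2n}\to\mathbb F_2$ with $|\hat f(\lambda)|=2^n$ for all $\lambda\in V_{2n}$. A bent square of order $2^n$ is a matrix with rows and columns indexed by $V_n$, each of whose lines (rows and columns) is a spectral sequence of a Boolean function of $n$ variables; let $\square\mathcal B_n$ be the set of bent squares. Let $\mathcal A_n$ be the set of affine functions $x\mapsto\langle\alpha,x\rangle+\gamma$ on $V_n$, and $\mathcal Q_n$ the set of Boolean functions $q$ of $n$ variables for which $\hat q$ has exactly four nonzero values. Let $\square\mathcal B_n^{(\mathcal A)}$ be the set of bent squares all of whose lines are spectral sequences of functions from $\mathcal A_n$ (they correspond to the Maiorana--McFarland bent functions), and $\square\mathcal B_n^{(\mathcal{AQ},e)}$ the set of bent squares all of whose lines are spectral sequences of functions from $\mathcal A_n\cup\mathcal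 Q_n$ and exactly $e$ of whose rows are spectral sequences of functions from $\mathcal Q_n$. For $2\le d\le 2^{n-1}$ put $$N_n(d)=\left(\left(\frac{(2^n-1)(2^{n-1})!}{(2^{n-1}-d)!}\right)^2 2^{4d}\sum_{i=0}^d\frac{(-1)^i}{i!}-\delta_n(d)\right)(2^n-2d)!\,2^{2^n-2d},$$ where $\delta_n(d)=0$ for odd $d$ and, for even $d$, $$\delta_n(d)=(d/2)!\,2^{9d/2}\left(\tfrac43 s_n(d)r_n(d)-\tfrac49 r_n(d)^2\right),$$ $$s_n(d)=(2^n-1)\frac{(2^{n-1})!}{2^{d/2}(2^{n-1}-d)!\,(d/2)!},\qquad r_n(d)=(2^n-1)(2^{n-1}-1)\binom{2^{n-2}}{d/2}.$$ Then, for $n=4$, $|\square\mathcal B_4^{(\mathcal A)}|=2^{2^4}\cdot(2^4)!$ and $|\square\mathcal B_4^{(\mathcal{AQ},2d)}|\ge N_4(d)$ for $d=2,\dots,8$, the sum of these bounds is $$2^{2^4}\cdot(2^4)!+\sum_{d=2}^8 N_4(d)=1559994535674013286400,$$ and $$|\mathcal B_8|=|\square\mathcal B_4|\ \ge\ |\square\mathcal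 B_4^{(\mathcal A)}|+\sum_{d=2}^{8}|\square\mathcal B_4^{(\mathcal{AQ},2d)}|\ \ge\ 1559994535674013286400\approx 2^{70.4}.$$ In particular $|\mathcal B_8|\ge 1559994535674013286400$. Here $\approx 2^{70.4}$ means that the base-2 logarithm of the number differs from $70.4$ by less than $0.05$. -/

import Mathlib

namespace BentSquares

/-- The `n`-dimensional vector space over the field with two elements. -/
abbrev V (n : ℕ) : Type := Fin n → ZMod 2

/-- Boolean functions of `n` variables. -/
abbrev BoolFun (n : ℕ) : Type := V n → ZMod 2

/-- The sign `(-1)^γ` of an element `γ` of the field with two elements. -/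
def sgn (γ : ZMod 2) : ℤ := (-1) ^ γ.val

/-- The Walsh–Hadamard transform; as a vector indexed by `V n`, it is the spectral sequence
of `f`. -/
def walsh {n : ℕ} (f : BoolFun n) (l : V n) : ℤ := ∑ x : V n, sgn (f x) * sgn (l ⬝ᵥ x)

/-- Bent functions of `2 * n` variables. -/
def bentFunctions (n : ℕ) : Set (BoolFun (2 * n)) := {f | ∀ l, |walsh f l| = 2 ^ n}

/-- Affine functions of `n` variables. -/
def affineFunctions (n : ℕ) : Set (BoolFun n) :=
  {f | ∃ (a : V n) (c : ZMod 2), ∀ x, f x = a ⬝ᵥ x + c}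

/-- Functions of `n` variables whose Walsh–Hadamard transform has exactly four nonzero values. -/
def fourFunctions (n : ℕ) : Set (BoolFun n) := {q | {l : V n | walsh q l ≠ 0}.ncard = 4}

/-- Matrices of order `2 ^ n`, rows and columns indexed by `V n`, all of whose rows and
(transposed) columns are spectral sequences of functions from `S`. -/
def squaresWithLinesIn {n : ℕ} (S : Set (BoolFun n)) : Set (Matrix (V n) (V n) ℤ) :=
  {M | (∀ i, ∃ f ∈ S, M.row i = walsh f) ∧ (∀ j, ∃ g ∈ S, M.col j = walsh g)}

/-- Bent squares of order `2 ^ n`: all rows and all columns are spectral sequences. -/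
def bentSquares (n : ℕ) : Set (Matrix (V n) (V n) ℤ) :=
  squaresWithLinesIn (Set.univ : Set (BoolFun n))

/-- Bent squares whose lines are spectral sequences of affine functions. -/
def bentSquaresA (n : ℕ) : Set (Matrix (V n) (V n) ℤ) := squaresWithLinesIn (affineFunctions n)

/-- Bent squares whose lines are spectral sequences of functions that are affine or have exactly
four nonzero spectral values. -/
def bentSquaresAQ (n : ℕ) : Set (Matrix (V n) (V n) ℤ) :=
  squaresWithLinesIn (affineFunctions n ∪ fourFunctions n)

/-- The indices of the rows that are spectral sequences of functions from `fourFunctions n`. -/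
def fourRows {n : ℕ} (M : Matrix (V n) (V n) ℤ) : Set (V n) :=
  {i | ∃ q ∈ fourFunctions n, M.row i = walsh q}

/-- Members of `bentSquaresAQ n` with exactly `e` rows of the second kind. -/
def bentSquaresAQCount (n e : ℕ) : Set (Matrix (V n) (V n) ℤ) :=
  {M | M ∈ bentSquaresAQ n ∧ (fourRows M).ncard = e}

open scoped Nat in
/-- `s_n(d)`, used for even `d` with `2 ≤ d ≤ 2 ^ (n - 1)` and `2 ≤ n`. -/
def sNum (n d : ℕ) : ℚ :=
  (2 ^ n - 1) * (((2 ^ (n - 1))! : ℚ) / (2 ^ (d / 2) * (2 ^ (n - 1) - d)! * (d / 2)!))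

/-- `r_n(d)`, used for even `d` with `2 ≤ d ≤ 2 ^ (n - 1)` and `2 ≤ n`. -/
def rNum (n d : ℕ) : ℚ :=
  (2 ^ n - 1) * (2 ^ (n - 1) - 1) * ((2 ^ (n - 2)).choose (d / 2) : ℚ)

open scoped Nat in
/-- The correction term `δ_n(d)`. -/
def deltaNum (n d : ℕ) : ℚ :=
  if Even d then
    ((d / 2)! : ℚ) * 2 ^ (9 * d / 2) *
      (4 / 3 * sNum n d * rNum n d - 4 / 9 * rNum n d ^ 2)
  else 0

open scoped Nat in
/-- The lower bound for the number of bent squares in `bentSquaresAQCount n (2 * d)`, for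
`2 ≤ d ≤ 2 ^ (n - 1)` and `2 ≤ n`. -/
def aqBound (n d : ℕ) : ℚ :=
  (((2 ^ n - 1) * ((2 ^ (n - 1))! : ℚ) / ((2 ^ (n - 1) - d)! : ℚ)) ^ 2 * 2 ^ (4 * d) *
      (∑ i ∈ Finset.range (d + 1), (-1 : ℚ) ^ i / (i ! : ℚ)) - deltaNum n d) *
    ((2 ^ n - 2 * d)! : ℚ) * 2 ^ (2 ^ n - 2 * d)

end BentSquares

namespace BentSquares

/-! Writing `V 8` as `V 4 × V 4` and transforming in the second half of the variables turns a
Boolean function into a matrix whose rows are spectral sequences; transforming down the columns then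
gives the full transform. The function is therefore bent exactly when the columns are spectral
sequences too (`image_squareOf`), and it suffices to construct many bent squares. Squares with
affine lines are the scaled signed permutation matrices, which gives the first term.

For the other terms, put entries `±8` on an affine plane, with an odd number of minus signs: this is
a spectral sequence (`isFourLine_of_isPlane`). A core is a `2d × 2d` array of such lines. Any signed
bijection between the remaining rows and columns completes it, and the core can be read off from the
completed square, so every core contributes `(16-2d)! 2^(16-2d)` squares
(`card_mul_le_ncard_bentSquaresAQCount`).

Cores come from two sources. (1) Choose a direction and `d` pairs of vectors with that difference,
for rows and for columns. Join each row pair `x` to two column pairs `σ x` and `σ (π x)`, where `π`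
has no fixed point, and choose signs. For a given choice of pairs there are `2^(4d)` sign
parameters, and the signs also encode which `σ, π` produced the support (`Filling.ext_of_nbr_sign`).
The directions are recovered if `π` is not an involution (`blocks_eq`). (2) For `d = 2k`, match `k`
disjoint planes of rows with `k` disjoint planes of columns and put a sign matrix with odd line sums
in each of the `k` blocks. This replaces the involutive case, where a plane does not determine a
direction. The two kinds never coincide (`PairedDatum.core_ne_core`).

The factor `∑ (-1)^i / i!` in `aqBound` comes from derangements. The correction satisfies `δ = k!
2^(9k) (s² - (s - 2r/3)²)`: it removes the involutive `π` and adds back plane families, with `s -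
2r/3` of them on each side. For `n = 4` and even `d` from 2 to 8 these numbers are 140, 2730, 6020,
1505, confirmed as lower bounds by enumeration (`disjointCount_values`). -/

/-! ### Signs and the Walsh–Hadamard transform. -/

theorem sgn_add (a b : ZMod 2) : sgn (a + b) = sgn a * sgn b := by
  revert a b; decide

theorem sgn_zero : sgn 0 = 1 := by decide

theorem sgn_injective : Function.Injective sgn := by decide

theorem sgn_ne_zero (a : ZMod 2) : sgn a ≠ 0 := by revert a; decide

theorem abs_sgn (a : ZMod 2) : |sgn a| = 1 := by revert a; decide

theorem exists_sgn_of_abs {z : ℤ} {m : ℤ} (h : |z| = m) : ∃ a, z = m * sgn a := by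
  rcases abs_choice z with h' | h'
  · exact ⟨0, by rw [sgn_zero]; lia⟩
  · exact ⟨1, by rw [show sgn 1 = -1 by decide]; lia⟩

theorem zmod_two_add_self (a : ZMod 2) : a + a = 0 := CharTwo.add_self_eq_zero a

theorem vec_add_self {n : ℕ} (a : V n) : a + a = 0 := funext fun _ => zmod_two_add_self _

/-- The Walsh–Hadamard transform of integer-valued functions. -/
def transform {n : ℕ} (w : V n → ℤ) (l : V n) : ℤ := ∑ x, w x * sgn (l ⬝ᵥ x)

theorem walsh_eq_transform {n : ℕ} (f : BoolFun n) : walsh f = transform fun x => sgn (f x) := rfl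

theorem sum_sgn_dotProduct {n : ℕ} (l : V n) :
    ∑ x : V n, sgn (l ⬝ᵥ x) = if l = 0 then 2 ^ n else 0 := by
  split_ifs with h
  · simp [h, sgn_zero]
  · obtain ⟨i, hi⟩ := Function.ne_iff.mp h
    have h1 : l i = 1 := by
      have : ∀ a : ZMod 2, a ≠ 0 → a = 1 := by decide
      exact this _ hi
    -- Translation by a unit vector at a coordinate where `l` is nonzero flips every sign, so the
    -- sum equals its negative.
    have : ∑ x : V n, sgn (l ⬝ᵥ x) = ∑ x : V n, -sgn (l ⬝ᵥ x) := by
      refine Fintype.sum_equiv (Equiv.addRight (Pi.single i 1)) _ _ fun x => ?_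
      simp only [Equiv.coe_addRight, dotProduct_add, dotProduct_single, mul_one, h1, sgn_add]
      simp [show sgn 1 = -1 by decide]
    rw [Finset.sum_neg_distrib] at this
    lia

theorem transform_transform {n : ℕ} (w : V n → ℤ) (x : V n) :
    transform (transform w) x = 2 ^ n * w x := by
  unfold transform
  simp_rw [Finset.sum_mul]
  rw [Finset.sum_comm]
  have (y : V n) : ∑ l : V n, w y * sgn (l ⬝ᵥ y) * sgn (x ⬝ᵥ l)
      = w y * if y = x then 2 ^ n else 0 := by
    have h : (y = x) = (y + x = 0) := by
      rw [eq_iff_iff, add_eq_zero_iff_eq_neg, show -x = x from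
        (neg_eq_of_add_eq_zero_left (vec_add_self x))]
    simp_rw [h, ← sum_sgn_dotProduct, Finset.mul_sum, mul_assoc, ← sgn_add, add_dotProduct,
      dotProduct_comm _ y]
  simp only [this]
  simp [mul_comm]

theorem transform_const_mul {n : ℕ} (c : ℤ) (w : V n → ℤ) (x : V n) :
    transform (fun y => c * w y) x = c * transform w x := by
  simp [transform, Finset.mul_sum, mul_assoc]

theorem transform_walsh {n : ℕ} (f : BoolFun n) (x : V n) :
    transform (walsh f) x = 2 ^ n * sgn (f x) := by
  rw [walsh_eq_transform, transform_transform]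

theorem walsh_injective {n : ℕ} : Function.Injective (walsh (n := n)) := by
  intro f g h
  funext x
  have := transform_walsh f x
  rw [h, transform_walsh] at this
  exact (sgn_injective (mul_left_cancel₀ (by positivity) this)).symm

theorem eq_walsh_iff {n : ℕ} (w : V n → ℤ) (f : BoolFun n) :
    w = walsh f ↔ ∀ x, transform w x = 2 ^ n * sgn (f x) := by
  constructor
  · rintro rfl x
    exact transform_walsh f x
  · intro h
    funext x
    have h2 : transform (transform w) x = 2 ^ n * walsh f x := by
      rw [walsh_eq_transform, ← transform_const_mul]
      congr 1
      exact funext h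
    rw [transform_transform] at h2
    exact mul_left_cancel₀ (by positivity) h2

/-- By inversion the only candidate for `f` is the sign pattern of the transform of `w`. This is the
criterion by which lines are recognised as spectral sequences. -/
theorem exists_eq_walsh_iff {n : ℕ} (w : V n → ℤ) :
    (∃ f, w = walsh f) ↔ ∀ x, |transform w x| = 2 ^ n := by
  constructor
  · rintro ⟨f, rfl⟩ x
    rw [transform_walsh, abs_mul, abs_sgn]
    simp
  · intro h
    choose f hf using fun x => exists_sgn_of_abs (h x)
    exact ⟨f, (eq_walsh_iff w f).mpr hf⟩

/-! ### Lines with four nonzero entries and affine lines. -/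

/-- Spectral sequences of functions with exactly four nonzero spectral values. -/
def IsFourLine (w : V 4 → ℤ) : Prop := ∃ q ∈ fourFunctions 4, w = walsh q

/-- Affine planes in `V 4`. -/
def IsPlane (P : Finset (V 4)) : Prop := P.card = 4 ∧ ∑ x ∈ P, x = 0

theorem abs_sum_sgn_of_card_four {α : Type*} {P : Finset α} (hP : P.card = 4) (s : α → ZMod 2)
    (hs : ∑ j ∈ P, s j = 1) : |∑ j ∈ P, sgn (s j)| = 2 := by
  classical
  obtain ⟨a, b, c, d, hab, hac, had, hbc, hbd, hcd, rfl⟩ := Finset.card_eq_four.mp hP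
  rw [Finset.sum_insert (by simp [*]), Finset.sum_insert (by simp [*]),
    Finset.sum_insert (by simp [*]), Finset.sum_singleton] at hs ⊢
  have : ∀ a b c d : ZMod 2, a + (b + (c + d)) = 1 →
      |sgn a + (sgn b + (sgn c + sgn d))| = 2 := by decide
  exact this _ _ _ _ hs

/-- The points of a plane sum to zero, so a character `x ⬝ᵥ j` does not change the parity of the
number of minus signs. Four signs with an odd number of minus signs add up to `±2`, so every
transform value is `±16`. -/
theorem isFourLine_of_isPlane {P : Finset (V 4)} (hP : IsPlane P) (s : V 4 → ZMod 2)
    (hs : ∑ j ∈ P, s j = 1) : IsFourLine fun j => if j ∈ P then 8 * sgn (s j) else 0 := by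
  have h : ∀ x, |transform (fun j => if j ∈ P then 8 * sgn (s j) else 0) x| = 2 ^ 4 := by
    intro x
    have h1 : transform (fun j => if j ∈ P then 8 * sgn (s j) else 0) x
        = 8 * ∑ j ∈ P, sgn (s j + x ⬝ᵥ j) := by
      simp [transform, ite_mul, Finset.sum_ite_mem, Finset.mul_sum, sgn_add, mul_assoc]
    rw [h1, abs_mul, abs_sum_sgn_of_card_four hP.1]
    · norm_num
    · rw [Finset.sum_add_distrib, hs, ← dotProduct_sum, hP.2]
      simp
  obtain ⟨q, hq⟩ := (exists_eq_walsh_iff _).mpr h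
  refine ⟨q, ?_, hq⟩
  have : {l : V 4 | walsh q l ≠ 0} = P := by
    ext l
    simp [← hq, sgn_ne_zero]
  rw [fourFunctions, Set.mem_ofPred_eq, this, Set.ncard_coe_finset, hP.1]

theorem IsFourLine.ncard_support {w : V 4 → ℤ} (hw : IsFourLine w) :
    {l | w l ≠ 0}.ncard = 4 := by
  obtain ⟨q, hq, rfl⟩ := hw
  exact hq

theorem walsh_affine {n : ℕ} (f : BoolFun n) (a : V n) (c : ZMod 2) (hf : ∀ x, f x = a ⬝ᵥ x + c) :
    walsh f = fun j => if j = a then 2 ^ n * sgn c else 0 := by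
  symm
  rw [eq_walsh_iff]
  intro x
  simp only [transform, ite_mul, zero_mul, Finset.sum_ite_eq', Finset.mem_univ, if_true, hf,
    sgn_add, dotProduct_comm x a]
  ring

theorem exists_affine_eq_walsh {n : ℕ} (a : V n) (c : ZMod 2) :
    ∃ f ∈ affineFunctions n, (fun j => if j = a then 2 ^ n * sgn c else 0) = walsh f :=
  ⟨fun x => a ⬝ᵥ x + c, ⟨a, c, fun _ => rfl⟩, (walsh_affine _ a c fun _ => rfl).symm⟩


/-! ### Bent functions as bent squares. -/

/-- The concatenation of two vectors. -/
def joinVec (n : ℕ) : V n × V n ≃ V (2 * n) :=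
  (Equiv.sumArrowEquivProdArrow (Fin n) (Fin n) (ZMod 2)).symm.trans
    (Equiv.arrowCongr (finSumFinEquiv.trans (finCongr (two_mul n).symm)) (Equiv.refl _))

theorem joinVec_dotProduct {n : ℕ} (a b c d : V n) :
    joinVec n (a, b) ⬝ᵥ joinVec n (c, d) = a ⬝ᵥ c + b ⬝ᵥ d := by
  simp only [dotProduct]
  rw [← (finSumFinEquiv.trans (finCongr (two_mul n).symm)).sum_comp, Fintype.sum_sum_type]
  refine congrArg₂ (· + ·) (Finset.sum_congr rfl fun i _ => ?_)
    (Finset.sum_congr rfl fun i _ => ?_) <;>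
  simp only [joinVec, Equiv.trans_apply, Equiv.arrowCongr_apply, Function.comp_apply,
    Equiv.symm_trans_apply, Equiv.symm_apply_apply, Equiv.refl_apply] <;> rfl

/-- The matrix whose rows are the spectral sequences of the restrictions of `f`. -/
def squareOf {n : ℕ} (f : BoolFun (2 * n)) : Matrix (V n) (V n) ℤ :=
  fun i => walsh fun y => f (joinVec n (i, y))

theorem transform_squareOf_col {n : ℕ} (f : BoolFun (2 * n)) (j k : V n) :
    transform ((squareOf f).col j) k = walsh f (joinVec n (k, j)) := by
  rw [walsh, ← (joinVec n).sum_comp, Fintype.sum_prod_type]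
  simp only [transform, Matrix.col, Matrix.transpose_apply, squareOf, walsh, Finset.sum_mul,
    joinVec_dotProduct, sgn_add]
  exact Finset.sum_congr rfl fun x _ => Finset.sum_congr rfl fun y _ => by ring

theorem squareOf_injective {n : ℕ} : Function.Injective (squareOf (n := n)) := by
  intro f g h
  funext z
  obtain ⟨⟨i, y⟩, rfl⟩ := (joinVec n).surjective z
  exact congrFun (walsh_injective (congrFun h i)) y

/-- The rows of `squareOf f` are spectral sequences for every `f`, and every matrix with such rows
arises in this way. The columns transform to the values of `walsh f`, so the column condition is
exactly bentness. -/
theorem image_squareOf (n : ℕ) : squareOf '' bentFunctions n = bentSquares n := by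
  have key (f : BoolFun (2 * n)) :
      f ∈ bentFunctions n ↔ ∀ j, ∃ g ∈ Set.univ, (squareOf f).col j = walsh g := by
    simp only [Set.mem_univ, true_and, exists_eq_walsh_iff, transform_squareOf_col]
    constructor
    · intro h j k
      exact h _
    · intro h l
      obtain ⟨⟨k, j⟩, rfl⟩ := (joinVec n).surjective l
      exact h j k
  ext M
  constructor
  · rintro ⟨f, hf, rfl⟩
    exact ⟨fun i => ⟨_, Set.mem_univ _, rfl⟩, (key f).mp hf⟩
  · rintro ⟨hr, hc⟩
    choose r _ hr using hr
    have : squareOf (fun z => r ((joinVec n).symm z).1 ((joinVec n).symm z).2) = M := by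
      funext i
      simp only [squareOf, Equiv.symm_apply_apply]
      exact (hr i).symm
    exact ⟨_, (key _).mpr (this ▸ hc), this⟩

theorem ncard_bentFunctions (n : ℕ) : (bentFunctions n).ncard = (bentSquares n).ncard := by
  rw [← image_squareOf, Set.ncard_image_of_injective _ squareOf_injective]

theorem finite_bentSquares (n : ℕ) : (bentSquares n).Finite := by
  rw [← image_squareOf]
  exact (Set.toFinite _).image _

theorem squaresWithLinesIn_subset {n : ℕ} (S : Set (BoolFun n)) :
    squaresWithLinesIn S ⊆ bentSquares n :=
  fun _ hM => ⟨fun i => (hM.1 i).imp fun _ h => ⟨trivial, h.2⟩,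
    fun j => (hM.2 j).imp fun _ h => ⟨trivial, h.2⟩⟩

/-! ### Squares with affine lines. -/

/-- The signed permutation matrix, scaled by `2 ^ n`. -/
def signedPerm {n : ℕ} (p : Equiv.Perm (V n) × (V n → ZMod 2)) : Matrix (V n) (V n) ℤ :=
  fun i j => if j = p.1 i then 2 ^ n * sgn (p.2 i) else 0

theorem two_pow_mul_sgn_ne_zero (n : ℕ) (a : ZMod 2) : 2 ^ n * sgn a ≠ 0 :=
  mul_ne_zero (by positivity) (sgn_ne_zero a)

theorem two_pow_mul_sgn_injective (n : ℕ) : Function.Injective fun a => 2 ^ n * sgn a :=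
  fun _ _ h => sgn_injective (mul_left_cancel₀ (by positivity) h)

theorem signedPerm_injective {n : ℕ} : Function.Injective (signedPerm (n := n)) := by
  rintro ⟨π, s⟩ ⟨π', s'⟩ h
  have h1 (i j) : (if j = π i then 2 ^ n * sgn (s i) else 0)
      = if j = π' i then 2 ^ n * sgn (s' i) else 0 := congrFun (congrFun h i) j
  have h2 (i) : π i = π' i := by
    by_contra hne
    have := h1 i (π i)
    rw [if_pos rfl, if_neg hne] at this
    exact two_pow_mul_sgn_ne_zero _ _ this
  have h3 (i) : s i = s' i := by
    have := h1 i (π i)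
    rw [if_pos rfl, if_pos (h2 i)] at this
    exact two_pow_mul_sgn_injective n this
  exact Prod.ext (Equiv.ext h2) (funext h3)

theorem range_signedPerm (n : ℕ) : Set.range (signedPerm (n := n)) = bentSquaresA n := by
  ext M
  constructor
  · rintro ⟨⟨π, s⟩, rfl⟩
    refine ⟨fun i => exists_affine_eq_walsh (π i) (s i), fun j => ?_⟩
    obtain ⟨f, hf, h⟩ := exists_affine_eq_walsh (π.symm j) (s (π.symm j))
    refine ⟨f, hf, h ▸ funext fun i => ?_⟩
    simp only [Matrix.col, Matrix.transpose_apply, signedPerm, Equiv.eq_symm_apply, eq_comm (a := j)]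
    split_ifs with h
    · rw [← h, Equiv.symm_apply_apply]
    · rfl
  · rintro ⟨hr, hc⟩
    have hr' (i) : ∃ a c, ∀ j, M i j = if j = a then 2 ^ n * sgn c else 0 := by
      obtain ⟨f, ⟨a, c, hf⟩, h⟩ := hr i
      exact ⟨a, c, congrFun (h.trans (walsh_affine f a c hf))⟩
    have hc' (j) : ∃ a c, ∀ i, M i j = if i = a then 2 ^ n * sgn c else 0 := by
      obtain ⟨f, ⟨a, c, hf⟩, h⟩ := hc j
      exact ⟨a, c, congrFun (h.trans (walsh_affine f a c hf))⟩
    choose a s ha using hr'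
    choose b t hb using hc'
    -- The only nonzero entry of row `i` must also be the only nonzero entry of its column, so the
    -- position maps of rows and columns are mutually inverse.
    have hba (i) : b (a i) = i := by
      by_contra hne
      have := (ha i (a i)).symm.trans (hb (a i) i)
      rw [if_pos rfl, if_neg (Ne.symm hne)] at this
      exact two_pow_mul_sgn_ne_zero _ _ this
    have hab (j) : a (b j) = j := by
      by_contra hne
      have := (hb j (b j)).symm.trans (ha (b j) j)
      rw [if_pos rfl, if_neg (Ne.symm hne)] at this
      exact two_pow_mul_sgn_ne_zero _ _ this
    exact ⟨(⟨a, b, hba, hab⟩, s), funext fun i => funext fun j => (ha i j).symm⟩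

theorem ncard_bentSquaresA (n : ℕ) :
    (bentSquaresA n).ncard = 2 ^ 2 ^ n * (2 ^ n).factorial := by
  rw [← range_signedPerm, ← Set.image_univ, Set.ncard_image_of_injective _ signedPerm_injective,
    Set.ncard_univ, Nat.card_eq_fintype_card, Fintype.card_prod, Fintype.card_perm]
  simp [mul_comm]

/-! ### Cores and their completions. -/

/-- The part of a bent square of order `16` made of its lines with four nonzero entries. -/
structure IsCore (d : ℕ) (C : Matrix (V 4) (V 4) ℤ) (S T : Finset (V 4)) : Prop where
  card_rows : S.card = 2 * d
  card_cols : T.card = 2 * d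
  row_mem : ∀ i ∈ S, IsFourLine (C i)
  row_notMem : ∀ i ∉ S, ∀ j, C i j = 0
  col_mem : ∀ j ∈ T, IsFourLine fun i => C i j
  col_notMem : ∀ j ∉ T, ∀ i, C i j = 0

/-- The completion of a core by a signed bijection between the remaining rows and columns. -/
def complete (C : Matrix (V 4) (V 4) ℤ) (S T : Finset (V 4)) (e : {i // i ∉ S} ≃ {j // j ∉ T})
    (s : {i // i ∉ S} → ZMod 2) : Matrix (V 4) (V 4) ℤ :=
  fun i j => if h : i ∈ S then C i j else if j = e ⟨i, h⟩ then 2 ^ 4 * sgn (s ⟨i, h⟩) else 0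

theorem complete_of_mem {C : Matrix (V 4) (V 4) ℤ} {S T : Finset (V 4)}
    (e : {i // i ∉ S} ≃ {j // j ∉ T}) (s : {i // i ∉ S} → ZMod 2) {i : V 4} (h : i ∈ S) (j : V 4) :
    complete C S T e s i j = C i j := by
  rw [complete, dif_pos h]

theorem complete_of_notMem {C : Matrix (V 4) (V 4) ℤ} {S T : Finset (V 4)}
    (e : {i // i ∉ S} ≃ {j // j ∉ T}) (s : {i // i ∉ S} → ZMod 2) {i : V 4} (h : i ∉ S) (j : V 4) :
    complete C S T e s i j = if j = e ⟨i, h⟩ then 2 ^ 4 * sgn (s ⟨i, h⟩) else 0 := by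
  rw [complete, dif_neg h]

namespace IsCore

variable {d : ℕ} {C : Matrix (V 4) (V 4) ℤ} {S T : Finset (V 4)}

theorem complete_col_mem (hC : IsCore d C S T) (e : {i // i ∉ S} ≃ {j // j ∉ T})
    (s : {i // i ∉ S} → ZMod 2) {j : V 4} (hj : j ∈ T) (i : V 4) :
    complete C S T e s i j = C i j := by
  by_cases hi : i ∈ S
  · exact complete_of_mem e s hi j
  · rw [complete_of_notMem e s hi, hC.row_notMem i hi, if_neg]
    rintro rfl
    exact (e ⟨i, hi⟩).2 hj

theorem complete_col_notMem (hC : IsCore d C S T) (e : {i // i ∉ S} ≃ {j // j ∉ T})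
    (s : {i // i ∉ S} → ZMod 2) {j : V 4} (hj : j ∉ T) (i : V 4) :
    complete C S T e s i j
      = if i = e.symm ⟨j, hj⟩ then 2 ^ 4 * sgn (s (e.symm ⟨j, hj⟩)) else 0 := by
  by_cases hi : i ∈ S
  · rw [complete_of_mem e s hi, hC.col_notMem j hj, if_neg]
    rintro rfl
    exact (e.symm ⟨j, hj⟩).2 hi
  · rw [complete_of_notMem e s hi]
    by_cases h : j = e ⟨i, hi⟩
    · have : e.symm ⟨j, hj⟩ = ⟨i, hi⟩ := by
        rw [Equiv.symm_apply_eq]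
        exact Subtype.ext h
      rw [if_pos h, this, if_pos rfl]
    · rw [if_neg h, if_neg]
      intro h'
      have : (⟨i, hi⟩ : {i // i ∉ S}) = e.symm ⟨j, hj⟩ := Subtype.ext h'
      rw [this, Equiv.apply_symm_apply] at h
      exact h rfl

theorem complete_mem (hC : IsCore d C S T) (e : {i // i ∉ S} ≃ {j // j ∉ T})
    (s : {i // i ∉ S} → ZMod 2) : complete C S T e s ∈ bentSquaresAQ 4 := by
  constructor
  · intro i
    by_cases hi : i ∈ S
    · obtain ⟨q, hq, h⟩ := hC.row_mem i hi
      exact ⟨q, Or.inr hq, h ▸ funext fun j => complete_of_mem e s hi j⟩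
    · obtain ⟨f, hf, h⟩ := exists_affine_eq_walsh (n := 4) (e ⟨i, hi⟩) (s ⟨i, hi⟩)
      exact ⟨f, Or.inl hf, h ▸ funext fun j => complete_of_notMem e s hi j⟩
  · intro j
    by_cases hj : j ∈ T
    · obtain ⟨q, hq, h⟩ := hC.col_mem j hj
      exact ⟨q, Or.inr hq, h ▸ funext fun i => hC.complete_col_mem e s hj i⟩
    · obtain ⟨f, hf, h⟩ := exists_affine_eq_walsh (n := 4) (e.symm ⟨j, hj⟩) (s (e.symm ⟨j, hj⟩))
      exact ⟨f, Or.inl hf, h ▸ funext fun i => hC.complete_col_notMem e s hj i⟩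

/-- A completed row outside `S` has one nonzero entry, not four. Hence `S` can be recovered from the
square, and with it the core. -/
theorem fourRows_complete (hC : IsCore d C S T) (e : {i // i ∉ S} ≃ {j // j ∉ T})
    (s : {i // i ∉ S} → ZMod 2) : fourRows (complete C S T e s) = S := by
  ext i
  constructor
  · intro hi
    by_contra his
    have his : i ∉ S := his
    have h1 := IsFourLine.ncard_support hi
    have h2 : {j | (complete C S T e s).row i j ≠ 0} = {↑(e ⟨i, his⟩)} := by
      ext j
      have : (complete C S T e s).row i j = _ := complete_of_notMem e s his j
      rw [Set.mem_ofPred_eq, this, Set.mem_singleton_iff]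
      simp [sgn_ne_zero]
    rw [h2, Set.ncard_singleton] at h1
    lia
  · intro hi
    obtain ⟨q, hq, h⟩ := hC.row_mem i hi
    exact ⟨q, hq, h ▸ funext fun j => complete_of_mem e s hi j⟩

end IsCore

theorem finite_bentSquaresAQCount (n e : ℕ) : (bentSquaresAQCount n e).Finite :=
  (finite_bentSquares n).subset fun _ h => squaresWithLinesIn_subset _ h.1

/-- The square determines `S`, hence the core (zero outside the rows in `S`) and its datum; the
remaining rows then determine the bijection and its signs. Injectivity of `C` suffices, since `S`
and `T` may depend on the datum in any way. -/
theorem card_mul_le_ncard_bentSquaresAQCount {D : Type*} [Fintype D] {d : ℕ}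
    (C : D → Matrix (V 4) (V 4) ℤ) (S T : D → Finset (V 4)) (hinj : Function.Injective C)
    (hC : ∀ x, IsCore d (C x) (S x) (T x)) :
    Fintype.card D * ((16 - 2 * d).factorial * 2 ^ (16 - 2 * d))
      ≤ (bentSquaresAQCount 4 (2 * d)).ncard := by
  classical
  let E := Σ x : D, ({i // i ∉ S x} ≃ {j // j ∉ T x}) × ({i // i ∉ S x} → ZMod 2)
  let F : E → Matrix (V 4) (V 4) ℤ := fun y => complete (C y.1) (S y.1) (T y.1) y.2.1 y.2.2
  have hcard : Fintype.card E = Fintype.card D * ((16 - 2 * d).factorial * 2 ^ (16 - 2 * d)) := by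
    rw [Fintype.card_sigma, Finset.sum_const_nat (m := (16 - 2 * d).factorial * 2 ^ (16 - 2 * d)),
      Finset.card_univ]
    intro x _
    have h1 : Fintype.card {i // i ∉ S x} = 16 - 2 * d := by
      rw [Fintype.card_subtype_compl, Fintype.card_coe, (hC x).card_rows]
      simp
    have h2 : Fintype.card {i // i ∉ T x} = 16 - 2 * d := by
      rw [Fintype.card_subtype_compl, Fintype.card_coe, (hC x).card_cols]
      simp
    rw [Fintype.card_prod, Fintype.card_equiv (Fintype.equivOfCardEq (h1.trans h2.symm)), h1]
    simp [h1]
  have hF : Function.Injective F := by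
    rintro ⟨x, e, s⟩ ⟨x', e', s'⟩ h
    have hM : complete (C x) (S x) (T x) e s = complete (C x') (S x') (T x') e' s' := h
    have hS : S x = S x' := by
      have := (hC x).fourRows_complete e s
      rw [hM, (hC x').fourRows_complete e' s'] at this
      exact_mod_cast this.symm
    have hx : x = x' := by
      refine hinj (funext fun i => funext fun j => ?_)
      by_cases hi : i ∈ S x
      · rw [← complete_of_mem (C := C x) e s hi j, hM, complete_of_mem e' s' (hS ▸ hi)]
      · rw [(hC x).row_notMem i hi, (hC x').row_notMem i (hS ▸ hi)]
    subst hx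
    have h1 (i) (hi : i ∉ S x) : e ⟨i, hi⟩ = e' ⟨i, hi⟩ ∧ s ⟨i, hi⟩ = s' ⟨i, hi⟩ := by
      have := congrFun (congrFun hM i) (e ⟨i, hi⟩)
      rw [complete_of_notMem e s hi, complete_of_notMem e' s' hi, if_pos rfl] at this
      split_ifs at this with h2
      · exact ⟨Subtype.ext h2, two_pow_mul_sgn_injective 4 this⟩
      · exact absurd this (two_pow_mul_sgn_ne_zero _ _)
    have he : e = e' := Equiv.ext fun i => (h1 i.1 i.2).1
    have hs : s = s' := funext fun i => (h1 i.1 i.2).2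
    rw [he, hs]
  have hmem : Set.range F ⊆ bentSquaresAQCount 4 (2 * d) := by
    rintro _ ⟨⟨x, e, s⟩, rfl⟩
    refine ⟨(hC x).complete_mem e s, ?_⟩
    rw [(hC x).fourRows_complete e s, Set.ncard_coe_finset, (hC x).card_rows]
  rw [← hcard, ← Nat.card_eq_fintype_card, ← Set.ncard_univ, ← Set.ncard_image_of_injective _ hF,
    Set.image_univ]
  exact Set.ncard_le_ncard hmem (finite_bentSquaresAQCount _ _)

/-! ### Disjointness of the families of squares. -/

theorem disjoint_bentSquaresA_bentSquaresAQCount {n e : ℕ} (he : e ≠ 0) :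
    Disjoint (bentSquaresA n) (bentSquaresAQCount n e) := by
  rw [Set.disjoint_left]
  rintro M hA ⟨-, hM⟩
  refine he (hM ▸ ?_)
  have : fourRows M = ∅ := by
    rw [Set.eq_empty_iff_forall_notMem]
    rintro i ⟨q, hq, h⟩
    obtain ⟨f, ⟨a, c, hf⟩, h'⟩ := hA.1 i
    have hq : {l : V n | walsh q l ≠ 0}.ncard = 4 := hq
    have h2 : {l : V n | walsh q l ≠ 0} = {a} := by
      ext l
      rw [Set.mem_ofPred_eq, ← h, h', walsh_affine f a c hf, Set.mem_singleton_iff]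
      simp [sgn_ne_zero]
    rw [h2, Set.ncard_singleton] at hq
    lia
  rw [this, Set.ncard_empty]

theorem ncard_add_sum_le_ncard_bentSquares (n : ℕ) (I : Finset ℕ) (hI : 0 ∉ I) :
    (bentSquaresA n).ncard + ∑ d ∈ I, (bentSquaresAQCount n (2 * d)).ncard
      ≤ (bentSquares n).ncard := by
  have hfin (J : Finset ℕ) : (⋃ d ∈ J, bentSquaresAQCount n (2 * d)).Finite :=
    J.finite_toSet.biUnion fun d _ => finite_bentSquaresAQCount n _
  have hU (J : Finset ℕ) : (⋃ d ∈ J, bentSquaresAQCount n (2 * d)).ncard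
      = ∑ d ∈ J, (bentSquaresAQCount n (2 * d)).ncard := by
    induction J using Finset.induction_on with
    | empty => simp
    | insert a J ha ih =>
      rw [Finset.sum_insert ha, ← ih, Finset.set_biUnion_insert,
        Set.ncard_union_eq _ (finite_bentSquaresAQCount n _) (hfin J)]
      rw [Set.disjoint_iUnion₂_right]
      intro b hb
      rw [Set.disjoint_left]
      rintro M ⟨-, h1⟩ ⟨-, h2⟩
      exact ha ((show a = b by lia) ▸ hb)
  have hA : (bentSquaresA n).Finite := (finite_bentSquares n).subset (squaresWithLinesIn_subset _)
  rw [← hU, ← Set.ncard_union_eq _ hA (hfin I)]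
  · refine Set.ncard_le_ncard (Set.union_subset (squaresWithLinesIn_subset _) ?_)
      (finite_bentSquares n)
    exact Set.iUnion₂_subset fun d _ M hM => squaresWithLinesIn_subset _ hM.1
  · rw [Set.disjoint_iUnion₂_right]
    intro d hd
    refine disjoint_bentSquaresA_bentSquaresAQCount ?_
    rintro h
    exact hI ((show d = 0 by lia) ▸ hd)


/-! ### Derangements and involutions. -/

/-- Fixed point free permutations that are not involutions. -/
abbrev NonInv (X : Type*) : Type _ := {π : Equiv.Perm X // (∀ x, π x ≠ x) ∧ ∃ x, π (π x) ≠ x}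

/-- A fixed-point-free involution consists of 2-cycles only, so the formula for the number of
permutations of a given cycle type applies. There are none on a set of odd size. Nonemptiness is
what excludes the identity. -/
theorem card_involution_mul_le {X : Type*} [Fintype X] [DecidableEq X] [Nonempty X] :
    Fintype.card {π : Equiv.Perm X // (∀ x, π x ≠ x) ∧ ∀ x, π (π x) = x} *
      (2 ^ (Fintype.card X / 2) * (Fintype.card X / 2).factorial)
      ≤ if Even (Fintype.card X) then (Fintype.card X).factorial else 0 := by
  have hct (π : Equiv.Perm X) (h1 : ∀ x, π x ≠ x) (h2 : ∀ x, π (π x) = x) :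
      ∃ m, 2 * m = Fintype.card X ∧ π.cycleType = Multiset.replicate m 2 := by
    have ho : orderOf π = 2 := by
      refine orderOf_eq_prime (Equiv.ext fun x => ?_) fun h => ?_
      · simp [pow_two, h2]
      · exact h1 (Classical.arbitrary X) (by rw [h]; rfl)
    obtain ⟨m, hm⟩ := Equiv.Perm.cycleType_prime_order (σ := π) (ho ▸ Nat.prime_two)
    rw [ho] at hm
    refine ⟨m + 1, ?_, hm⟩
    have h3 := Equiv.Perm.sum_cycleType π
    have h4 : π.support = Finset.univ := by
      ext x
      simp [h1 x]
    rw [hm, h4, Multiset.sum_replicate, Finset.card_univ, smul_eq_mul] at h3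
    lia
  split_ifs with he
  · obtain ⟨m, hm⟩ := even_iff_two_dvd.mp he
    have h1 := Equiv.Perm.card_of_cycleType_mul_eq X (Multiset.replicate m 2)
    rw [if_pos ⟨by simp [hm, mul_comm], fun a ha => by simp [Multiset.eq_of_mem_replicate ha]⟩,
      Multiset.sum_replicate, Multiset.prod_replicate, smul_eq_mul,
      show Fintype.card X - m * 2 = 0 by lia] at h1
    have h2 : Fintype.card X / 2 = m := by lia
    rw [h2]
    have h5 : ∏ n ∈ (Multiset.replicate m 2).toFinset,
        (Multiset.count n (Multiset.replicate m 2)).factorial = m.factorial := by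
      rcases Nat.eq_zero_or_pos m with rfl | h0
      · simp
      · rw [Multiset.toFinset_replicate, if_neg h0.ne']
        simp
    rw [h5, Nat.factorial_zero, one_mul] at h1
    rw [← h1]
    refine Nat.mul_le_mul_right _ ?_
    rw [Fintype.card_subtype]
    refine Finset.card_le_card fun π hπ => ?_
    simp only [Finset.mem_filter, Finset.mem_univ, true_and] at hπ ⊢
    obtain ⟨m', hm', h⟩ := hct π hπ.1 hπ.2
    rw [h, show m' = m by lia]
  · have : IsEmpty {π : Equiv.Perm X // (∀ x, π x ≠ x) ∧ ∀ x, π (π x) = x} := by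
      refine ⟨fun π => he ?_⟩
      obtain ⟨m, hm, -⟩ := hct π.1 π.2.1 π.2.2
      exact ⟨m, by lia⟩
    simp

theorem numDerangements_le {X : Type*} [Fintype X] [DecidableEq X] :
    numDerangements (Fintype.card X) ≤ Fintype.card (NonInv X)
      + Fintype.card {π : Equiv.Perm X // (∀ x, π x ≠ x) ∧ ∀ x, π (π x) = x} := by
  rw [← card_derangements_eq_numDerangements X]
  simp only [Fintype.card_subtype]
  refine le_trans (le_of_eq ?_) (Finset.card_union_le _ _)
  congr 1
  ext π
  simp only [Finset.mem_filter, Finset.mem_univ, true_and, Finset.mem_union, ← and_or_left,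
    ← not_forall]
  exact ⟨fun h => ⟨h, (em _).symm⟩, fun h => h.1⟩

theorem sum_zmod_two {M : Type*} [AddCommMonoid M] (f : ZMod 2 → M) :
    ∑ a, f a = f 0 + f 1 := Fin.sum_univ_two f

/-! ### Supports given by pairs of bijections, and their signs. -/

section Filling

set_option linter.unusedSectionVars false

variable {X Y : Type} [DecidableEq X] [DecidableEq Y]

/-- Pairs `(σ, τ)` of bijections that disagree everywhere, `τ` being `π` followed by `σ`; the
involutive `π` are left out. -/
abbrev Pairing (X Y : Type) : Type := (X ≃ Y) × NonInv X

namespace Pairing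

/-- The two neighbours of `x`. -/
def nbr (c : Pairing X Y) (x : X) : Finset Y := {c.1 x, c.1 (c.2.1 x)}

/-- The indicator of the first neighbour. -/
def col (c : Pairing X Y) (x : X) (y : Y) : ZMod 2 := if y = c.1 x then 1 else 0

theorem ne (c : Pairing X Y) (x : X) : c.1 x ≠ c.1 (c.2.1 x) :=
  fun h => c.2.2.1 x (c.1.injective h).symm

theorem mem_nbr {c : Pairing X Y} {x : X} {y : Y} :
    y ∈ nbr c x ↔ y = c.1 x ∨ y = c.1 (c.2.1 x) := by
  simp [nbr]

theorem card_nbr (c : Pairing X Y) (x : X) : (nbr c x).card = 2 := Finset.card_pair (c.ne x)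

theorem sum_col (c : Pairing X Y) (x : X) : ∑ y ∈ nbr c x, col c x y = 1 := by
  rw [nbr, Finset.sum_pair (c.ne x)]
  simp [col, c.2.2.1 x]

/-- The pairing with the roles of `X` and `Y` exchanged. -/
def swap (c : Pairing X Y) : Pairing Y X :=
  (c.1.symm, ⟨c.1.symm.trans (c.2.1.symm.trans c.1), fun y h => by
      have h : c.1 (c.2.1.symm (c.1.symm y)) = y := h
      rw [← Equiv.eq_symm_apply, Equiv.symm_apply_eq] at h
      exact c.2.2.1 _ h.symm, by
    obtain ⟨x, hx⟩ := c.2.2.2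
    refine ⟨c.1 x, fun h => hx ?_⟩
    simp only [Equiv.trans_apply, Equiv.symm_apply_apply] at h
    have h := c.1.injective h
    rw [Equiv.symm_apply_eq, Equiv.symm_apply_eq] at h
    exact h.symm⟩)

theorem mem_nbr_swap {c : Pairing X Y} {x : X} {y : Y} : x ∈ nbr c.swap y ↔ y ∈ nbr c x := by
  simp only [mem_nbr, swap, Equiv.trans_apply, Equiv.symm_apply_apply, Equiv.eq_symm_apply]
  rw [eq_comm, eq_comm (b := y)]

theorem sum_col_swap (c : Pairing X Y) (y : Y) : ∑ x ∈ nbr c.swap y, col c x y = 1 := by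
  rw [nbr, Finset.sum_pair (c.swap.ne y)]
  have h1 : col c (c.swap.1 y) y = 1 := by simp [col, swap]
  have h2 : col c (c.swap.1 (c.swap.2.1 y)) y = 0 := by
    simp only [col, swap, Equiv.trans_apply, Equiv.symm_apply_apply, ite_eq_right_iff,
      one_ne_zero, imp_false]
    intro h
    rw [← Equiv.symm_apply_eq, Equiv.eq_symm_apply] at h
    exact c.2.2.1 _ h
  rw [h1, h2, add_zero]

/-- A pairing chosen among all pairings with the same neighbourhoods. -/
noncomputable def base (c : Pairing X Y) : Pairing X Y :=
  (Quotient.mk (Setoid.ker (nbr : Pairing X Y → X → Finset Y)) c).out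

theorem nbr_base (c : Pairing X Y) : nbr (base c) = nbr c :=
  Quotient.mk_out (s := Setoid.ker (nbr : Pairing X Y → X → Finset Y)) c

theorem base_eq_of_nbr_eq {c c' : Pairing X Y} (h : nbr c = nbr c') : base c = base c' := by
  have : Quotient.mk (Setoid.ker (nbr : Pairing X Y → X → Finset Y)) c
      = Quotient.mk (Setoid.ker (nbr : Pairing X Y → X → Finset Y)) c' := Quotient.sound h
  rw [base, this, base]

/-- The representative `base c` depends only on the neighbourhoods. It distinguishes the two
neighbours of each `x` in a way that can be recovered from the support alone. -/
theorem sum_col_base (c : Pairing X Y) (x : X) : ∑ y ∈ nbr c x, col (base c) x y = 1 := by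
  rw [← nbr_base, sum_col]

theorem nbr_swap_base (c : Pairing X Y) (y : Y) : nbr (base c).swap y = nbr c.swap y := by
  ext x
  rw [mem_nbr_swap, mem_nbr_swap, nbr_base]

theorem sum_col_base_swap (c : Pairing X Y) (y : Y) :
    ∑ x ∈ nbr c.swap y, col (base c) x y = 1 := by
  rw [← nbr_swap_base, sum_col_swap]

theorem col_eq_one_iff {c : Pairing X Y} {x : X} {y : Y} : col c x y = 1 ↔ y = c.1 x := by
  simp [col]

theorem ext_of_nbr_col {c c' : Pairing X Y} (h1 : nbr c = nbr c')
    (h2 : ∀ x, ∀ y ∈ nbr c x, col c x y = col c' x y) : c = c' := by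
  have h3 (x : X) : c.1 x = c'.1 x := by
    have := h2 x (c.1 x) (mem_nbr.mpr (Or.inl rfl))
    rw [col_eq_one_iff.mpr rfl] at this
    exact col_eq_one_iff.mp this.symm
  have h4 (x : X) : c.2.1 x = c'.2.1 x := by
    have : c.1 (c.2.1 x) ∈ nbr c' x := h1 ▸ mem_nbr.mpr (Or.inr rfl)
    rcases mem_nbr.mp this with h | h
    · rw [← h3] at h
      exact absurd h.symm (c.ne x)
    · rw [← h3] at h
      exact c.1.injective h
  exact Prod.ext (Equiv.ext h3) (Subtype.ext (Equiv.ext h4))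

end Pairing

/-- A pairing together with the free parameters of the signs. -/
abbrev Filling (X Y : Type) : Type :=
  Pairing X Y × (X → ZMod 2) × (Y → ZMod 2) × (X × ZMod 2 → ZMod 2)

namespace Filling

/-- The sign of an entry. -/
noncomputable def sign (f : Filling X Y) (z : X × ZMod 2) (w : Y × ZMod 2) : ZMod 2 :=
  f.2.2.2 (z.1, f.1.base.col z.1 w.1)
    + w.2 * (f.2.1 z.1 + f.1.base.col z.1 w.1) + z.2 * (f.2.2.1 w.1 + f.1.base.col z.1 w.1)
    + z.2 * w.2 * (f.1.col z.1 w.1 + f.1.base.col z.1 w.1)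

/-- Within one block, row `(x, e)` sums to `a x + c' + e (c + c')`, where `c` and `c'` are the
values of `col` for the actual and the base pairing. Over the two neighbours `a x` occurs twice,
while `c` and `c'` each sum to 1, which leaves 1. -/
theorem sum_sign_row (f : Filling X Y) (z : X × ZMod 2) :
    ∑ w ∈ f.1.nbr z.1 ×ˢ Finset.univ, sign f z w = 1 := by
  have h (y : Y) : ∑ e, sign f z (y, e)
      = f.2.1 z.1 + (f.1.base.col z.1 y + z.2 * (f.1.col z.1 y + f.1.base.col z.1 y)) := by
    rw [sum_zmod_two]
    simp only [sign]
    generalize f.1.base.col z.1 y = c', f.1.col z.1 y = c, f.2.1 _ = a, f.2.2.1 _ = b, z.2 = e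
    generalize f.2.2.2 _ = k
    revert k a b c c' e
    decide
  rw [Finset.sum_product, Finset.sum_congr rfl fun y _ => h y, Finset.sum_add_distrib,
    Finset.sum_add_distrib, ← Finset.mul_sum, Finset.sum_add_distrib, f.1.sum_col_base,
    f.1.sum_col, Finset.sum_const, f.1.card_nbr, two_nsmul, zmod_two_add_self, zmod_two_add_self]
  simp

theorem sum_sign_col (f : Filling X Y) (w : Y × ZMod 2) :
    ∑ z ∈ f.1.swap.nbr w.1 ×ˢ Finset.univ, sign f z w = 1 := by
  have h (x : X) : ∑ e, sign f (x, e) w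
      = f.2.2.1 w.1 + (f.1.base.col x w.1 + w.2 * (f.1.col x w.1 + f.1.base.col x w.1)) := by
    rw [sum_zmod_two]
    simp only [sign]
    generalize f.1.base.col x w.1 = c', f.1.col x w.1 = c, f.2.1 _ = a, f.2.2.1 _ = b, w.2 = e
    generalize f.2.2.2 _ = k
    revert k a b c c' e
    decide
  rw [Finset.sum_product, Finset.sum_congr rfl fun y _ => h y, Finset.sum_add_distrib,
    Finset.sum_add_distrib, ← Finset.mul_sum, Finset.sum_add_distrib, f.1.sum_col_base_swap,
    f.1.sum_col_swap, Finset.sum_const, f.1.swap.card_nbr, two_nsmul, zmod_two_add_self,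
    zmod_two_add_self]
  simp

/-- In a block, the entries at `(0,0)`, `(0,1)`, `(1,0)`, `(1,1)` successively reveal `k`, `a`, `b`
and the colouring of the pairing. Pairings with equal neighbourhoods thus still give different
signs, and nothing is counted twice. -/
theorem ext_of_nbr_sign {f g : Filling X Y} (h1 : f.1.nbr = g.1.nbr)
    (h2 : ∀ z w, w.1 ∈ f.1.nbr z.1 → sign f z w = sign g z w) : f = g := by
  obtain ⟨c, a, b, k⟩ := f
  obtain ⟨c', a', b', k'⟩ := g
  have hb : c'.base = c.base := (Pairing.base_eq_of_nbr_eq h1).symm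
  simp only [sign, hb] at h2
  have hk (x : X) (y : Y) (hy : y ∈ c.nbr x) :
      k (x, c.base.col x y) = k' (x, c.base.col x y) := by
    simpa using h2 (x, 0) (y, 0) hy
  have ha (x : X) (y : Y) (hy : y ∈ c.nbr x) : a x = a' x := by
    simpa [hk x y hy] using h2 (x, 0) (y, 1) hy
  have hbb (x : X) (y : Y) (hy : y ∈ c.nbr x) : b y = b' y := by
    simpa [hk x y hy] using h2 (x, 1) (y, 0) hy
  have hc (x : X) (y : Y) (hy : y ∈ c.nbr x) : c.col x y = c'.col x y := by
    simpa [hk x y hy, ha x y hy, hbb x y hy] using h2 (x, 1) (y, 1) hy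
  have e1 : c = c' := Pairing.ext_of_nbr_col h1 hc
  have e2 : a = a' := funext fun x => ha x _ (Pairing.mem_nbr.mpr (Or.inl rfl))
  have e3 : b = b' := funext fun y =>
    hbb (c.1.symm y) y (Pairing.mem_nbr.mpr (Or.inl (c.1.apply_symm_apply y).symm))
  -- Both values of the second argument of `k` occur: the two neighbours of `x` under the base
  -- pairing have colours 1 and 0.
  have e4 : k = k' := by
    funext ⟨x, e⟩
    have he : e = 1 ∨ e = 0 := by
      revert e
      decide
    rcases he with rfl | rfl
    · have := hk x (c.base.1 x) (Pairing.nbr_base c ▸ Pairing.mem_nbr.mpr (Or.inl rfl))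
      rwa [Pairing.col_eq_one_iff.mpr rfl] at this
    · have := hk x (c.base.1 (c.base.2.1 x)) (Pairing.nbr_base c ▸ Pairing.mem_nbr.mpr (Or.inr rfl))
      rwa [Pairing.col, if_neg (c.base.ne x).symm] at this
  rw [e1, e2, e3, e4]

end Filling

end Filling


/-! ### Extending arrays by zero to order 16. -/

theorem isFourLine_extend {κ : Type*} [DecidableEq κ] {b : κ → V 4} (hb : Function.Injective b)
    {P : Finset κ} (hP : P.card = 4) (hsum : ∑ w ∈ P, b w = 0) (s : κ → ZMod 2)
    (hs : ∑ w ∈ P, s w = 1) :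
    IsFourLine (Function.extend b (fun w => if w ∈ P then 8 * sgn (s w) else 0) 0) := by
  have h := isFourLine_of_isPlane (P := P.map ⟨b, hb⟩) ⟨by rw [Finset.card_map, hP], by
    rw [Finset.sum_map]; exact hsum⟩ (Function.extend b s 0) (by
      rw [Finset.sum_map, ← hs]
      exact Finset.sum_congr rfl fun w _ => hb.extend_apply s 0 w)
  convert h using 1
  funext j
  by_cases hj : ∃ w, b w = j
  · obtain ⟨w, rfl⟩ := hj
    rw [hb.extend_apply, hb.extend_apply]
    congr 1
    simp
  · rw [Function.extend_apply' _ _ _ hj, if_neg]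
    · rfl
    · rw [Finset.mem_map]
      rintro ⟨w, -, hw⟩
      exact hj ⟨w, hw⟩

/-- The extension by zero of a matrix along maps of the row and column indices. -/
noncomputable def place {κ κ' : Type*} (a : κ → V 4) (b : κ' → V 4) (F : κ → κ' → ℤ) :
    Matrix (V 4) (V 4) ℤ :=
  fun i j => Function.extend a (fun z => Function.extend b (F z) 0 j) 0 i

section Place

variable {κ κ' : Type*} {a : κ → V 4} {b : κ' → V 4} (ha : Function.Injective a)
  (hb : Function.Injective b) (F : κ → κ' → ℤ)

include ha in
theorem place_row (z : κ) : place a b F (a z) = Function.extend b (F z) 0 := by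
  funext j
  rw [place, ha.extend_apply]

include hb in
theorem place_col (w : κ') :
    (fun i => place a b F i (b w)) = Function.extend a (fun z => F z w) 0 := by
  funext i
  simp only [place, hb.extend_apply]

include ha hb in
theorem place_apply (z : κ) (w : κ') : place a b F (a z) (b w) = F z w := by
  rw [place_row ha, hb.extend_apply]

theorem place_of_notMem_row {i : V 4} (hi : ¬∃ z, a z = i) (j : V 4) : place a b F i j = 0 := by
  rw [place, Function.extend_apply' _ _ _ hi]
  rfl

include ha in
theorem place_of_notMem_col {j : V 4} (hj : ¬∃ w, b w = j) (i : V 4) : place a b F i j = 0 := by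
  by_cases hi : ∃ z, a z = i
  · obtain ⟨z, rfl⟩ := hi
    rw [place_row ha, Function.extend_apply' _ _ _ hj]
    rfl
  · exact place_of_notMem_row F hi j

end Place

/-! ### Pairs of vectors with a common difference. -/

theorem exists_split (u : {u : V 4 // u ≠ 0}) :
    ∃ e : V 3 × ZMod 2 ≃ V 4, ∀ y, e (y, 1) = e (y, 0) + u.1 := by
  obtain ⟨k, hk⟩ := Function.ne_iff.mp u.2
  have hk : u.1 k = 1 := by
    have : ∀ a : ZMod 2, a ≠ 0 → a = 1 := by decide
    exact this _ hk
  -- The vectors vanishing at coordinate `k` represent the cosets of `{0, u}`, because adding `u`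
  -- flips that coordinate.
  let g : V 3 × ZMod 2 → V 4 := fun z => k.insertNth 0 z.1 + z.2 • u.1
  have hg : Function.Injective g := by
    rintro ⟨y, e⟩ ⟨y', e'⟩ h
    have h1 : e = e' := by
      have := congrFun h k
      simpa [g, hk] using this
    subst h1
    have h2 := add_right_cancel h
    rw [Prod.mk.injEq]
    exact ⟨(Fin.insertNth_injective2 h2).2, rfl⟩
  have hb : Function.Bijective g := by
    rw [Fintype.bijective_iff_injective_and_card]
    exact ⟨hg, by simp [ZMod.card]⟩
  exact ⟨Equiv.ofBijective g hb, fun y => by simp [g]⟩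

/-- A splitting of `V 4` into pairs with difference `u`. -/
noncomputable def split (u : {u : V 4 // u ≠ 0}) : V 3 × ZMod 2 ≃ V 4 := (exists_split u).choose

theorem split_one (u : {u : V 4 // u ≠ 0}) (y : V 3) : split u (y, 1) = split u (y, 0) + u.1 :=
  (exists_split u).choose_spec y

/-- A direction and `d` pairs of vectors with this difference. -/
abbrev Blocks (d : ℕ) : Type := {u : V 4 // u ≠ 0} × {X : Finset (V 3) // X.card = d}

namespace Blocks

variable {d : ℕ}

/-- The elements of the pairs. -/
noncomputable def emb (r : Blocks d) (z : r.2.1 × ZMod 2) : V 4 := split r.1 (z.1, z.2)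

theorem emb_injective (r : Blocks d) : Function.Injective r.emb := by
  rintro ⟨x, e⟩ ⟨x', e'⟩ h
  have := (split r.1).injective h
  rw [Prod.mk.injEq] at this ⊢
  exact ⟨Subtype.ext this.1, this.2⟩

theorem emb_one (r : Blocks d) (x : r.2.1) : r.emb (x, 1) = r.emb (x, 0) + r.1.1 := split_one _ _

theorem emb_add (r : Blocks d) (z : r.2.1 × ZMod 2) : r.emb z + r.1.1 = r.emb (z.1, z.2 + 1) := by
  obtain ⟨x, e⟩ := z
  have he : e = 0 ∨ e = 1 := by
    revert e
    decide
  rcases he with rfl | rfl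
  · rw [zero_add, emb_one]
  · rw [emb_one, add_assoc, vec_add_self, add_zero]
    rfl

theorem sum_emb (r : Blocks d) {P : Finset r.2.1} (hP : P.card = 2) :
    ∑ z ∈ P ×ˢ Finset.univ, r.emb z = 0 := by
  have h (x : r.2.1) : ∑ e, r.emb (x, e) = r.1.1 := by
    rw [sum_zmod_two, emb_one, ← add_assoc, vec_add_self, zero_add]
  rw [Finset.sum_product, Finset.sum_congr rfl fun x _ => h x, Finset.sum_const, hP, two_nsmul,
    vec_add_self]

theorem card_image_emb (r : Blocks d) : (Finset.univ.image r.emb).card = 2 * d := by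
  rw [Finset.card_image_of_injective _ r.emb_injective, Finset.card_univ, Fintype.card_prod,
    Fintype.card_coe, r.2.2, ZMod.card, mul_comm]

theorem card (d : ℕ) : Fintype.card (Blocks d) = 15 * Nat.choose 8 d := by
  rw [Fintype.card_prod, Fintype.card_finset_len, Fintype.card_subtype_compl]
  simp [ZMod.card]

theorem ext_of_range {r r' : Blocks d} (h1 : r.1 = r'.1) (h2 : Set.range r.emb = Set.range r'.emb) :
    r = r' := by
  obtain ⟨u, X, hX⟩ := r
  obtain ⟨u', X', hX'⟩ := r'
  simp only at h1
  subst h1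
  have h3 (Z : Finset (V 3)) (hZ : Z.card = d) (x : V 3) :
      x ∈ Z ↔ split u (x, 0) ∈ Set.range (emb (u, ⟨Z, hZ⟩)) := by
    constructor
    · intro hx
      exact ⟨(⟨x, hx⟩, 0), rfl⟩
    · rintro ⟨⟨⟨y, hy⟩, e⟩, h⟩
      have := (split u).injective h
      rw [Prod.mk.injEq] at this
      exact this.1 ▸ hy
  have : X = X' := by
    ext x
    rw [h3 X hX, h3 X' hX', h2]
  subst this
  rfl

end Blocks

/-- The entries of a filling. -/
noncomputable def Filling.entry {X Y : Type} [DecidableEq X] [DecidableEq Y] (f : Filling X Y)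
    (z : X × ZMod 2) (w : Y × ZMod 2) : ℤ :=
  if w ∈ f.1.nbr z.1 ×ˢ Finset.univ then 8 * sgn (f.sign z w) else 0

theorem eight_mul_sgn_injective : Function.Injective fun a => 8 * sgn a :=
  fun _ _ h => sgn_injective (mul_left_cancel₀ (by simp) h)

theorem Filling.entry_ne_zero {X Y : Type} [DecidableEq X] [DecidableEq Y] {f : Filling X Y}
    {z : X × ZMod 2} {w : Y × ZMod 2} : f.entry z w ≠ 0 ↔ w.1 ∈ f.1.nbr z.1 := by
  simp [entry, sgn_ne_zero]

theorem Filling.entry_injective {X Y : Type} [DecidableEq X] [DecidableEq Y] :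
    Function.Injective (Filling.entry (X := X) (Y := Y)) := by
  intro f g h
  have h1 : f.1.nbr = g.1.nbr := by
    funext x
    ext y
    rw [← entry_ne_zero (f := f) (z := (x, 0)) (w := (y, 0)), h, entry_ne_zero]
  refine ext_of_nbr_sign h1 fun z w hw => ?_
  have h2 := congrFun (congrFun h z) w
  rw [entry, entry, if_pos (by simpa using hw), if_pos (by simpa [← h1] using hw)] at h2
  exact eight_mul_sgn_injective h2

/-! ### Cores from paired data. -/

/-- A pair of block systems together with a filling. -/
abbrev PairedDatum (d : ℕ) : Type := Σ p : Blocks d × Blocks d, Filling p.1.2.1 p.2.2.1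

namespace PairedDatum

variable {d : ℕ}

/-- The core of a datum. -/
noncomputable def core (x : PairedDatum d) : Matrix (V 4) (V 4) ℤ :=
  place x.1.1.emb x.1.2.emb x.2.entry

theorem isCore (x : PairedDatum d) :
    IsCore d x.core (Finset.univ.image x.1.1.emb) (Finset.univ.image x.1.2.emb) where
  card_rows := x.1.1.card_image_emb
  card_cols := x.1.2.card_image_emb
  row_mem i hi := by
    obtain ⟨z, -, rfl⟩ := Finset.mem_image.mp hi
    rw [core, place_row x.1.1.emb_injective]
    exact isFourLine_extend x.1.2.emb_injective
      (by rw [Finset.card_product, x.2.1.card_nbr, Finset.card_univ, ZMod.card])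
      (x.1.2.sum_emb (x.2.1.card_nbr _)) _ (x.2.sum_sign_row z)
  row_notMem i hi j := place_of_notMem_row _ (by simpa using hi) j
  col_mem j hj := by
    obtain ⟨w, -, rfl⟩ := Finset.mem_image.mp hj
    rw [core, place_col x.1.2.emb_injective]
    have h := isFourLine_extend x.1.1.emb_injective
      (by rw [Finset.card_product, x.2.1.swap.card_nbr, Finset.card_univ, ZMod.card])
      (x.1.1.sum_emb (x.2.1.swap.card_nbr _)) _ (x.2.sum_sign_col w)
    convert h using 2
    funext z
    simp [Filling.entry, Pairing.mem_nbr_swap]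
  col_notMem j hj i := place_of_notMem_col x.1.1.emb_injective _ (by simpa using hj) i

end PairedDatum

/-- Rows with the same support. -/
def SameSupport (C : Matrix (V 4) (V 4) ℤ) (i i' : V 4) : Prop := ∀ j, C i j ≠ 0 ↔ C i' j ≠ 0

theorem sameSupport_iff {d : ℕ} {r t : Blocks d} (c : Pairing r.2.1 t.2.1)
    {C : Matrix (V 4) (V 4) ℤ} (h1 : ∀ z w, C (r.emb z) (t.emb w) ≠ 0 ↔ w.1 ∈ c.nbr z.1)
    (h2 : ∀ i j, C i j ≠ 0 → (∃ z, r.emb z = i) ∧ ∃ w, t.emb w = j) (z : r.2.1 × ZMod 2) (i : V 4) :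
    SameSupport C (r.emb z) i ↔ ∃ z', r.emb z' = i ∧ c.nbr z.1 = c.nbr z'.1 := by
  constructor
  · intro h
    have h3 : C i (t.emb (c.1 z.1, 0)) ≠ 0 :=
      (h _).mp ((h1 _ _).mpr (Pairing.mem_nbr.mpr (Or.inl rfl)))
    obtain ⟨⟨z', rfl⟩, -⟩ := h2 _ _ h3
    refine ⟨z', rfl, Finset.ext fun y => ?_⟩
    rw [← h1 z (y, 0), ← h1 z' (y, 0)]
    exact h _
  · rintro ⟨z', rfl, h⟩ j
    by_cases hj : ∃ w, t.emb w = j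
    · obtain ⟨w, rfl⟩ := hj
      rw [h1, h1, h]
    · exact iff_of_false (fun h => hj (h2 _ _ h).2) fun h => hj (h2 _ _ h).2

/-- Equal neighbourhoods of `x` and `x' ≠ x` would mean `{x, π x} = {x', π x'}`, hence `x' = π x`
and `π (π x) = x`. For an `x` that violates the last equation, only the two rows of its own pair
share a support. -/
theorem exists_sameSupport_iff {d : ℕ} {r t : Blocks d} (c : Pairing r.2.1 t.2.1)
    {C : Matrix (V 4) (V 4) ℤ} (h1 : ∀ z w, C (r.emb z) (t.emb w) ≠ 0 ↔ w.1 ∈ c.nbr z.1)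
    (h2 : ∀ i j, C i j ≠ 0 → (∃ z, r.emb z = i) ∧ ∃ w, t.emb w = j) :
    ∃ z, ∀ i, SameSupport C (r.emb z) i ↔ i = r.emb z ∨ i = r.emb z + r.1.1 := by
  obtain ⟨x, hx⟩ := c.2.2.2
  refine ⟨(x, 0), fun i => ?_⟩
  rw [sameSupport_iff c h1 h2]
  constructor
  · rintro ⟨⟨x', e⟩, rfl, h⟩
    have hxx : x = x' := by
      have h3 : c.1 x' ∈ c.nbr x := h ▸ Pairing.mem_nbr.mpr (Or.inl rfl)
      have h4 : c.1 (c.2.1 x') ∈ c.nbr x := h ▸ Pairing.mem_nbr.mpr (Or.inr rfl)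
      rw [Pairing.mem_nbr, c.1.injective.eq_iff, c.1.injective.eq_iff] at h3 h4
      rcases h3 with h3 | h3
      · exact h3.symm
      · subst h3
        rcases h4 with h4 | h4
        · exact absurd h4 hx
        · exact absurd h4 (c.2.2.1 _)
    subst hxx
    have he : ∀ e : ZMod 2, e = 0 ∨ e = 1 := by decide
    rcases he e with rfl | rfl
    · exact Or.inl rfl
    · exact Or.inr (r.emb_one x)
  · rintro (rfl | rfl)
    · exact ⟨_, rfl, rfl⟩
    · exact ⟨(x, 1), r.emb_one x, rfl⟩

theorem sameSupport_add {d : ℕ} {r t : Blocks d} (c : Pairing r.2.1 t.2.1)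
    {C : Matrix (V 4) (V 4) ℤ} (h1 : ∀ z w, C (r.emb z) (t.emb w) ≠ 0 ↔ w.1 ∈ c.nbr z.1)
    (h2 : ∀ i j, C i j ≠ 0 → (∃ z, r.emb z = i) ∧ ∃ w, t.emb w = j) (z : r.2.1 × ZMod 2) :
    SameSupport C (r.emb z) (r.emb z + r.1.1) :=
  (sameSupport_iff c h1 h2 z _).mpr ⟨_, (r.emb_add z).symm, rfl⟩

theorem range_emb_eq {d : ℕ} {r t : Blocks d} (c : Pairing r.2.1 t.2.1)
    {C : Matrix (V 4) (V 4) ℤ} (h1 : ∀ z w, C (r.emb z) (t.emb w) ≠ 0 ↔ w.1 ∈ c.nbr z.1)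
    (h2 : ∀ i j, C i j ≠ 0 → (∃ z, r.emb z = i) ∧ ∃ w, t.emb w = j) :
    Set.range r.emb = {i | ∃ j, C i j ≠ 0} := by
  ext i
  constructor
  · rintro ⟨z, rfl⟩
    exact ⟨t.emb (c.1 z.1, 0), (h1 _ _).mpr (Pairing.mem_nbr.mpr (Or.inl rfl))⟩
  · rintro ⟨j, hj⟩
    exact (h2 _ _ hj).1

/-- A row that shares its support with exactly one other row exhibits the direction `u` as their
difference. Any second description of the same core makes its own direction a translation preserving
row supports, so the directions agree. The nonzero rows then give the pairs. -/
theorem blocks_eq {d : ℕ} {r t r' t' : Blocks d} (c : Pairing r.2.1 t.2.1)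
    (c' : Pairing r'.2.1 t'.2.1)
    {C : Matrix (V 4) (V 4) ℤ} (h1 : ∀ z w, C (r.emb z) (t.emb w) ≠ 0 ↔ w.1 ∈ c.nbr z.1)
    (h2 : ∀ i j, C i j ≠ 0 → (∃ z, r.emb z = i) ∧ ∃ w, t.emb w = j)
    (h1' : ∀ z w, C (r'.emb z) (t'.emb w) ≠ 0 ↔ w.1 ∈ c'.nbr z.1)
    (h2' : ∀ i j, C i j ≠ 0 → (∃ z, r'.emb z = i) ∧ ∃ w, t'.emb w = j) : r = r' := by
  have hr : Set.range r.emb = Set.range r'.emb := by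
    rw [range_emb_eq c h1 h2, range_emb_eq c' h1' h2']
  refine Blocks.ext_of_range ?_ hr
  obtain ⟨z, hz⟩ := exists_sameSupport_iff c h1 h2
  obtain ⟨z', hz'⟩ : r.emb z ∈ Set.range r'.emb := hr ▸ ⟨z, rfl⟩
  have h3 := sameSupport_add c' h1' h2' z'
  rw [hz', hz] at h3
  rcases h3 with h3 | h3
  · exact absurd (add_eq_left.mp h3) r'.1.2
  · exact Subtype.ext (add_left_cancel h3).symm

namespace PairedDatum

variable {d : ℕ} (x : PairedDatum d)

theorem core_emb_ne_zero (z) (w) :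
    x.core (x.1.1.emb z) (x.1.2.emb w) ≠ 0 ↔ w.1 ∈ x.2.1.nbr z.1 := by
  rw [core, place_apply x.1.1.emb_injective x.1.2.emb_injective, Filling.entry_ne_zero]

theorem mem_range_of_core_ne_zero (i j : V 4) (h : x.core i j ≠ 0) :
    (∃ z, x.1.1.emb z = i) ∧ ∃ w, x.1.2.emb w = j :=
  ⟨not_not.mp fun hi => h (place_of_notMem_row _ hi j),
    not_not.mp fun hj => h (place_of_notMem_col x.1.1.emb_injective _ hj i)⟩

theorem core_injective : Function.Injective (core (d := d)) := by
  intro x y h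
  have h1 : x.1.1 = y.1.1 :=
    blocks_eq x.2.1 y.2.1 x.core_emb_ne_zero x.mem_range_of_core_ne_zero
      (h ▸ y.core_emb_ne_zero) (h ▸ y.mem_range_of_core_ne_zero)
  -- The columns are the rows of the transpose, whose support is described by the swapped pairing.
  have h2 : x.1.2 = y.1.2 := by
    refine blocks_eq (C := x.core.transpose) x.2.1.swap y.2.1.swap (fun z w => ?_)
      (fun i j hij => (x.mem_range_of_core_ne_zero j i hij).symm) (fun z w => ?_)
      (fun i j hij => (y.mem_range_of_core_ne_zero j i (h ▸ hij)).symm)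
    · rw [Pairing.mem_nbr_swap]
      exact x.core_emb_ne_zero w z
    · rw [Pairing.mem_nbr_swap, h]
      exact y.core_emb_ne_zero w z
  obtain ⟨⟨r, t⟩, f⟩ := x
  obtain ⟨⟨r', t'⟩, g⟩ := y
  simp only at h1 h2
  subst h1 h2
  have : f = g := by
    refine Filling.entry_injective (funext fun z => funext fun w => ?_)
    have := congrFun (congrFun h (r.emb z)) (t.emb w)
    rwa [core, core, place_apply r.emb_injective t.emb_injective,
      place_apply r.emb_injective t.emb_injective] at this
  rw [this]

theorem exists_ncard_sameSupport :
    ∃ i, (∃ j, x.core i j ≠ 0) ∧ {i' | SameSupport x.core i i'}.ncard ≤ 2 := by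
  obtain ⟨z, hz⟩ := exists_sameSupport_iff x.2.1 x.core_emb_ne_zero x.mem_range_of_core_ne_zero
  refine ⟨x.1.1.emb z, ?_, ?_⟩
  · exact ⟨x.1.2.emb (x.2.1.1 z.1, 0),
      (x.core_emb_ne_zero _ _).mpr (Pairing.mem_nbr.mpr (Or.inl rfl))⟩
  · have : {i' | SameSupport x.core (x.1.1.emb z) i'}
        = {x.1.1.emb z, x.1.1.emb z + x.1.1.1.1} := by
      ext i
      exact hz i
    rw [this]
    exact (Set.ncard_insert_le _ _).trans (by simp)

end PairedDatum

instance {X Y : Type} [Fintype X] [Fintype Y] [DecidableEq X] [DecidableEq Y] :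
    Fintype (Filling X Y) := inferInstance

instance (d : ℕ) : Fintype (PairedDatum d) :=
  haveI (p : Blocks d × Blocks d) : Fintype (Filling p.1.2.1 p.2.2.1) := inferInstance
  inferInstance

theorem card_pairedDatum (d : ℕ) :
    Fintype.card (PairedDatum d) = (15 * Nat.choose 8 d) ^ 2 *
      (d.factorial * Fintype.card (NonInv (Fin d)) * 2 ^ (4 * d)) := by
  rw [Fintype.card_sigma, Finset.sum_const_nat
    (m := d.factorial * Fintype.card (NonInv (Fin d)) * 2 ^ (4 * d)), Finset.card_univ,
    Fintype.card_prod, Blocks.card, sq]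
  rintro ⟨r, t⟩ -
  have hr : Fintype.card r.2.1 = d := by rw [Fintype.card_coe, r.2.2]
  have ht : Fintype.card t.2.1 = d := by rw [Fintype.card_coe, t.2.2]
  have h1 : Fintype.card (NonInv r.2.1) = Fintype.card (NonInv (Fin d)) := by
    let e := Fintype.equivOfCardEq (hr.trans (Fintype.card_fin d).symm)
    refine Fintype.card_congr (e.permCongr.subtypeEquiv fun π => and_congr ?_ ?_)
    · rw [e.forall_congr_left]
      simp [Equiv.permCongr_apply, ← Equiv.eq_symm_apply]
    · rw [e.exists_congr_left]
      simp [Equiv.permCongr_apply, ← Equiv.eq_symm_apply]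
  rw [Fintype.card_prod, Fintype.card_prod, Fintype.card_equiv (Fintype.equivOfCardEq (hr.trans ht.symm)),
    h1, hr, Fintype.card_prod, Fintype.card_prod]
  simp only [Fintype.card_fun, Fintype.card_prod, hr, ht, ZMod.card]
  ring


/-! ### Cores from disjoint planes. -/

/-- Sets of `k` pairwise disjoint planes. -/
abbrev PlaneSet (k : ℕ) : Type :=
  {P : Finset (Finset (V 4)) //
    P.card = k ∧ (∀ p ∈ P, IsPlane p) ∧ (P : Set (Finset (V 4))).PairwiseDisjoint id}

noncomputable instance (k : ℕ) : Fintype (PlaneSet k) := Fintype.ofFinite _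

namespace PlaneSet

variable {k : ℕ} (P : PlaneSet k)

/-- An enumeration of a plane. -/
noncomputable def enum (p : P.1) : Fin 4 ≃ p.1 :=
  (p.1.equivFinOfCardEq (P.2.2.1 p.1 p.2).1).symm

/-- The points of the planes. -/
noncomputable def emb (z : P.1 × Fin 4) : V 4 := P.enum z.1 z.2

theorem emb_mem (z : P.1 × Fin 4) : P.emb z ∈ z.1.1 := (P.enum z.1 z.2).2

theorem exists_emb_eq {p : P.1} {i : V 4} (hi : i ∈ p.1) : ∃ t, P.emb (p, t) = i :=
  ⟨(P.enum p).symm ⟨i, hi⟩, by simp [emb]⟩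

variable {P}

theorem eq_of_mem {p q : P.1} {i : V 4} (hp : i ∈ p.1) (hq : i ∈ q.1) : p = q := by
  by_contra h
  exact Finset.disjoint_left.mp (P.2.2.2 p.2 q.2 fun h' => h (Subtype.ext h')) hp hq

variable (P)

theorem emb_injective : Function.Injective P.emb := by
  rintro ⟨p, t⟩ ⟨q, t'⟩ h
  have hpq : p = q := eq_of_mem (P.emb_mem (p, t)) (h ▸ P.emb_mem (q, t'))
  subst hpq
  have : t = t' := (P.enum p).injective (Subtype.ext h)
  rw [this]

theorem sum_emb (p : P.1) : ∑ z ∈ ({p} : Finset P.1) ×ˢ (Finset.univ : Finset (Fin 4)), P.emb z = 0 := by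
  rw [Finset.sum_product, Finset.sum_singleton, ← (P.2.2.1 p.1 p.2).2, ← Finset.sum_coe_sort p.1]
  exact (P.enum p).sum_comp fun i => i.1

theorem card_image_emb : (Finset.univ.image P.emb).card = 2 * (2 * k) := by
  rw [Finset.card_image_of_injective _ P.emb_injective, Finset.card_univ, Fintype.card_prod,
    Fintype.card_coe, P.2.1, Fintype.card_fin]
  ring

end PlaneSet

/-- Binary matrices of order `4` with odd line sums. -/
abbrev OddMatrix : Type :=
  {m : Fin 4 → Fin 4 → ZMod 2 // (∀ t, ∑ t', m t t' = 1) ∧ ∀ t', ∑ t, m t t' = 1}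

/-- The upper left `3 × 3` block is arbitrary, and the last row and column are then filled in. The
corner, the sum of all nine bits, serves both lines through it because 3 is odd. -/
theorem le_card_oddMatrix : 512 ≤ Fintype.card OddMatrix := by
  let g : (Fin 3 → Fin 3 → ZMod 2) → OddMatrix := fun b =>
    ⟨Fin.snoc (fun t => Fin.snoc (b t) (1 + ∑ t', b t t'))
      (Fin.snoc (fun t' => 1 + ∑ t, b t t') (∑ t, ∑ t', b t t')), by
    constructor
    · intro t
      refine Fin.lastCases ?_ (fun t => ?_) t
      · rw [Fin.snoc_last, Fin.sum_univ_castSucc]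
        simp only [Fin.snoc_castSucc, Fin.snoc_last]
        rw [Finset.sum_add_distrib, Finset.sum_comm, add_assoc, zmod_two_add_self]
        decide
      · rw [Fin.snoc_castSucc, Fin.sum_univ_castSucc]
        simp only [Fin.snoc_castSucc, Fin.snoc_last]
        rw [add_left_comm, zmod_two_add_self, add_zero]
    · intro t'
      rw [Fin.sum_univ_castSucc]
      simp only [Fin.snoc_castSucc, Fin.snoc_last]
      refine Fin.lastCases ?_ (fun t => ?_) t'
      · simp only [Fin.snoc_last]
        rw [Finset.sum_add_distrib, add_assoc, zmod_two_add_self]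
        decide
      · simp only [Fin.snoc_castSucc]
        rw [add_left_comm, zmod_two_add_self, add_zero]⟩
  have hg : Function.Injective g := by
    intro b b' h
    funext t t'
    have := congrFun (congrFun (congrArg Subtype.val h) t.castSucc) t'.castSucc
    simpa only [g, Fin.snoc_castSucc] using this
  have := Fintype.card_le_of_injective g hg
  simpa [ZMod.card] using this

/-- Two plane sets with a matching and signs. -/
abbrev PlaneDatum (k : ℕ) : Type :=
  Σ p : PlaneSet k × PlaneSet k, (p.1.1 ≃ p.2.1) × (p.1.1 → OddMatrix)

noncomputable instance (k : ℕ) : Fintype (PlaneDatum k) :=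
  haveI (p : PlaneSet k × PlaneSet k) : Fintype ((p.1.1 ≃ p.2.1) × (p.1.1 → OddMatrix)) :=
    inferInstance
  inferInstance

namespace PlaneDatum

variable {k : ℕ} (x : PlaneDatum k)

theorem mem_singleton_product_univ {α β : Type*} [Fintype β] {q : α} {w : α × β} :
    w ∈ ({q} : Finset α) ×ˢ (Finset.univ : Finset β) ↔ w.1 = q := by
  rw [Finset.mem_product, Finset.mem_singleton]
  exact and_iff_left (Finset.mem_univ _)

/-- The entries of the core. -/
def entry (z : x.1.1.1 × Fin 4) (w : x.1.2.1 × Fin 4) : ℤ :=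
  if w ∈ {x.2.1 z.1} ×ˢ Finset.univ then 8 * sgn ((x.2.2 z.1).1 z.2 w.2) else 0

/-- The core of a datum. -/
noncomputable def core : Matrix (V 4) (V 4) ℤ := place x.1.1.emb x.1.2.emb x.entry

theorem isCore : IsCore (2 * k) x.core (Finset.univ.image x.1.1.emb)
    (Finset.univ.image x.1.2.emb) where
  card_rows := x.1.1.card_image_emb
  card_cols := x.1.2.card_image_emb
  row_mem i hi := by
    obtain ⟨z, -, rfl⟩ := Finset.mem_image.mp hi
    rw [core, place_row x.1.1.emb_injective]
    refine isFourLine_extend x.1.2.emb_injective (by simp) (x.1.2.sum_emb _) _ ?_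
    rw [Finset.sum_product, Finset.sum_singleton]
    exact (x.2.2 z.1).2.1 z.2
  row_notMem i hi j := place_of_notMem_row _ (by simpa using hi) j
  col_mem j hj := by
    obtain ⟨w, -, rfl⟩ := Finset.mem_image.mp hj
    rw [core, place_col x.1.2.emb_injective]
    have h := isFourLine_extend x.1.1.emb_injective (by simp) (x.1.1.sum_emb (x.2.1.symm w.1))
      (fun z => (x.2.2 z.1).1 z.2 w.2) (by
        rw [Finset.sum_product, Finset.sum_singleton]
        exact (x.2.2 _).2.2 w.2)
    convert h using 2
    funext z
    simp only [entry, mem_singleton_product_univ, Equiv.eq_symm_apply, eq_comm]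
  col_notMem j hj i := place_of_notMem_col x.1.1.emb_injective _ (by simpa using hj) i

/-- The support is a union of products of matched planes. As the planes are disjoint, its lines are
these planes, so the plane sets and the matching can be read off. -/
theorem core_ne_zero_iff (i j : V 4) : x.core i j ≠ 0 ↔ ∃ p, i ∈ p.1 ∧ j ∈ (x.2.1 p).1 := by
  constructor
  · intro h
    obtain ⟨⟨p, t⟩, rfl⟩ : ∃ z, x.1.1.emb z = i :=
      not_not.mp fun hi => h (place_of_notMem_row _ hi j)
    obtain ⟨⟨q, t'⟩, rfl⟩ : ∃ w, x.1.2.emb w = j :=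
      not_not.mp fun hj => h (place_of_notMem_col x.1.1.emb_injective _ hj _)
    rw [core, place_apply x.1.1.emb_injective x.1.2.emb_injective] at h
    have h1 : q = x.2.1 p := by
      by_contra hq
      exact h (if_neg (mem_singleton_product_univ.not.mpr hq))
    exact ⟨p, x.1.1.emb_mem _, h1 ▸ x.1.2.emb_mem _⟩
  · rintro ⟨p, hi, hj⟩
    obtain ⟨t, rfl⟩ := x.1.1.exists_emb_eq hi
    obtain ⟨t', rfl⟩ := x.1.2.exists_emb_eq hj
    rw [core, place_apply x.1.1.emb_injective x.1.2.emb_injective]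
    simp [entry, sgn_ne_zero]

theorem mem_left_iff {p : x.1.1.1} {j : V 4} (hj : j ∈ (x.2.1 p).1) (i : V 4) :
    i ∈ p.1 ↔ x.core i j ≠ 0 := by
  rw [core_ne_zero_iff]
  refine ⟨fun h => ⟨p, h, hj⟩, fun ⟨q, hi, hq⟩ => ?_⟩
  rwa [x.2.1.injective (PlaneSet.eq_of_mem hj hq)]

theorem mem_right_iff {p : x.1.1.1} {i : V 4} (hi : i ∈ p.1) (j : V 4) :
    j ∈ (x.2.1 p).1 ↔ x.core i j ≠ 0 := by
  rw [core_ne_zero_iff]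
  refine ⟨fun h => ⟨p, hi, h⟩, fun ⟨q, hq, hj⟩ => ?_⟩
  rwa [PlaneSet.eq_of_mem hi hq]

theorem exists_of_core_eq {x y : PlaneDatum k} (h : x.core = y.core) (p : x.1.1.1) :
    ∃ q : y.1.1.1, q.1 = p.1 ∧ (y.2.1 q).1 = (x.2.1 p).1 := by
  have hi := x.1.1.emb_mem (p, 0)
  have hj := x.1.2.emb_mem (x.2.1 p, 0)
  obtain ⟨q, hi', hj'⟩ := (y.core_ne_zero_iff _ _).mp (h ▸ (x.mem_left_iff hj _).mp hi)
  refine ⟨q, Finset.ext fun i => ?_, Finset.ext fun j => ?_⟩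
  · rw [y.mem_left_iff hj', ← h, x.mem_left_iff hj]
  · rw [y.mem_right_iff hi', ← h, x.mem_right_iff hi]

theorem subset_of_core_eq {x y : PlaneDatum k} (h : x.core = y.core) :
    x.1.1.1 ⊆ y.1.1.1 ∧ x.1.2.1 ⊆ y.1.2.1 := by
  constructor
  · intro p hp
    obtain ⟨q, hq, -⟩ := exists_of_core_eq h ⟨p, hp⟩
    exact (show q.1 = p from hq) ▸ q.2
  · intro p hp
    obtain ⟨q, -, hq⟩ := exists_of_core_eq h (x.2.1.symm ⟨p, hp⟩)
    rw [Equiv.apply_symm_apply] at hq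
    exact (show (y.2.1 q).1 = p from hq) ▸ (y.2.1 q).2

theorem core_injective : Function.Injective (core (k := k)) := by
  intro x y h
  have h1 : x.1.1 = y.1.1 :=
    Subtype.ext ((subset_of_core_eq h).1.antisymm (subset_of_core_eq h.symm).1)
  have h2 : x.1.2 = y.1.2 :=
    Subtype.ext ((subset_of_core_eq h).2.antisymm (subset_of_core_eq h.symm).2)
  obtain ⟨⟨P, Q⟩, e, m⟩ := x
  obtain ⟨⟨P', Q'⟩, e', m'⟩ := y
  simp only at h1 h2
  subst h1 h2
  have he : e = e' := by
    refine Equiv.ext fun p => ?_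
    obtain ⟨q, hq, hq'⟩ := exists_of_core_eq h p
    have hq := Subtype.ext hq
    subst hq
    exact Subtype.ext hq'.symm
  subst he
  have hm : m = m' := by
    funext p
    refine Subtype.ext (funext fun t => funext fun t' => ?_)
    have := congrFun (congrFun h (P.emb (p, t))) (Q.emb (e p, t'))
    rw [core, core, place_apply P.emb_injective Q.emb_injective,
      place_apply P.emb_injective Q.emb_injective, entry, entry, if_pos (by simp),
      if_pos (by simp)] at this
    exact eight_mul_sgn_injective this
  rw [hm]

theorem four_le_ncard_sameSupport (i : V 4) (hi : ∃ j, x.core i j ≠ 0) :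
    4 ≤ {i' | SameSupport x.core i i'}.ncard := by
  obtain ⟨j, hj⟩ := hi
  obtain ⟨p, hp, hj⟩ := (x.core_ne_zero_iff _ _).mp hj
  refine ((x.1.1.2.2.1 p.1 p.2).1.symm.trans (Set.ncard_coe_finset p.1).symm).le.trans ?_
  refine Set.ncard_le_ncard fun i' hi' j' => ?_
  rw [← x.mem_right_iff hp, ← x.mem_right_iff (Finset.mem_coe.mp hi')]

end PlaneDatum

theorem le_card_planeDatum (k : ℕ) :
    Fintype.card (PlaneSet k) ^ 2 * (k.factorial * 512 ^ k) ≤ Fintype.card (PlaneDatum k) := by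
  rw [Fintype.card_sigma, sq, ← Fintype.card_prod, ← Finset.card_univ, ← smul_eq_mul]
  refine Finset.card_nsmul_le_sum _ _ _ fun p _ => ?_
  have h1 : Fintype.card p.1.1 = k := by rw [Fintype.card_coe, p.1.2.1]
  have h2 : Fintype.card p.2.1 = k := by rw [Fintype.card_coe, p.2.2.1]
  rw [Fintype.card_prod, Fintype.card_equiv (Fintype.equivOfCardEq (h1.trans h2.symm)),
    Fintype.card_fun, h1]
  exact Nat.mul_le_mul_left _ (Nat.pow_le_pow_left le_card_oddMatrix _)

/-! ### Combining the two kinds of cores. -/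

/-- In a paired core some nonzero row shares its support with at most one other row; in a plane core
every nonzero row belongs to at least four rows with the same support. -/
theorem PairedDatum.core_ne_core {k : ℕ} (x : PairedDatum (2 * k)) (y : PlaneDatum k) :
    x.core ≠ y.core := by
  intro h
  obtain ⟨i, hi, hle⟩ := x.exists_ncard_sameSupport
  have := y.four_le_ncard_sameSupport i (h ▸ hi)
  rw [h] at hle
  lia

theorem card_pairedDatum_mul_le (d : ℕ) :
    Fintype.card (PairedDatum d) * ((16 - 2 * d).factorial * 2 ^ (16 - 2 * d))
      ≤ (bentSquaresAQCount 4 (2 * d)).ncard :=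
  card_mul_le_ncard_bentSquaresAQCount _ _ _ PairedDatum.core_injective PairedDatum.isCore

theorem card_add_card_mul_le {d k : ℕ} (hd : d = 2 * k) :
    (Fintype.card (PairedDatum d) + Fintype.card (PlaneDatum k)) *
        ((16 - 2 * d).factorial * 2 ^ (16 - 2 * d))
      ≤ (bentSquaresAQCount 4 (2 * d)).ncard := by
  subst hd
  rw [← Fintype.card_sum]
  refine card_mul_le_ncard_bentSquaresAQCount
    (Sum.elim PairedDatum.core PlaneDatum.core)
    (Sum.elim (fun x => Finset.univ.image x.1.1.emb) fun x => Finset.univ.image x.1.1.emb)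
    (Sum.elim (fun x => Finset.univ.image x.1.2.emb) fun x => Finset.univ.image x.1.2.emb) ?_ ?_
  · exact PairedDatum.core_injective.sumElim PlaneDatum.core_injective PairedDatum.core_ne_core
  · rintro (x | x)
    · exact x.isCore
    · exact x.isCore


/-! ### Enumeration of disjoint planes by bit masks. -/

/-- The number of `k`-element sublists of pairwise disjoint bit masks. -/
def disjointCount : ℕ → List ℕ → ℕ
  | 0, _ => 1
  | k + 1, L => (L.tails.map fun
      | [] => 0
      | m :: l => disjointCount k (l.filter fun x => Nat.beq (Nat.land x m) 0)).sum

theorem disjointCount_succ_cons (k m : ℕ) (l : List ℕ) :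
    disjointCount (k + 1) (m :: l)
      = disjointCount k (l.filter fun x => Nat.beq (Nat.land x m) 0) + disjointCount (k + 1) l := by
  rw [disjointCount, disjointCount]
  simp [List.tails]

/-- The `k`-element sets of pairwise disjoint bit masks from a list. -/
def disjointSets (k : ℕ) (L : List ℕ) : Finset (Finset ℕ) :=
  (L.toFinset.powersetCard k).filter fun s => ∀ a ∈ s, ∀ b ∈ s, a ≠ b → a &&& b = 0

theorem mem_disjointSets {k : ℕ} {L : List ℕ} {s : Finset ℕ} :
    s ∈ disjointSets k L ↔
      ((∀ a ∈ s, a ∈ L) ∧ s.card = k) ∧ ∀ a ∈ s, ∀ b ∈ s, a ≠ b → a &&& b = 0 := by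
  simp [disjointSets, Finset.mem_powersetCard, Finset.subset_iff]

/-- Sets that contain the head `m` correspond to smaller sets among the masks disjoint from `m`; the
other sets come from the tail. This justifies the recursion evaluated by the kernel. -/
theorem disjointCount_le (k : ℕ) (L : List ℕ) (hL : L.Nodup) :
    disjointCount k L ≤ (disjointSets k L).card := by
  induction k generalizing L with
  | zero =>
    rw [disjointCount]
    exact Finset.card_pos.mpr ⟨∅, by simp [mem_disjointSets]⟩
  | succ k ihk =>
    induction L with
    | nil => simp [disjointCount]
    | cons m l ihl =>
      obtain ⟨hm, hl⟩ := List.nodup_cons.mp hL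
      rw [disjointCount_succ_cons]
      set l' := l.filter fun x => Nat.beq (Nat.land x m) 0 with hl'
      have hmem (x : ℕ) : x ∈ l' ↔ x ∈ l ∧ x &&& m = 0 := by
        rw [hl', List.mem_filter, Nat.beq_eq]
        rfl
      have hnot {s : Finset ℕ} (hs : s ∈ disjointSets k l') : m ∉ s := fun h =>
        hm ((hmem m).mp ((mem_disjointSets.mp hs).1.1 m h)).1
      have h1 : ((disjointSets k l').image (insert m)).card = (disjointSets k l').card := by
        refine Finset.card_image_of_injOn fun s hs t ht h => ?_
        rw [← Finset.erase_insert (hnot hs), ← Finset.erase_insert (hnot ht)]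
        exact congrArg (fun u => Finset.erase u m) h
      have h2 : Disjoint ((disjointSets k l').image (insert m)) (disjointSets (k + 1) l) := by
        rw [Finset.disjoint_left]
        rintro _ hs ht
        obtain ⟨s, -, rfl⟩ := Finset.mem_image.mp hs
        exact hm ((mem_disjointSets.mp ht).1.1 m (Finset.mem_insert_self _ _))
      refine (Nat.add_le_add (ihk l' (hl.filter _)) (ihl hl)).trans ?_
      rw [← h1, ← Finset.card_union_of_disjoint h2]
      refine Finset.card_le_card (Finset.union_subset ?_ ?_)
      · intro _ hs
        obtain ⟨s, hs', rfl⟩ := Finset.mem_image.mp hs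
        have hms := hnot hs'
        obtain ⟨⟨h3, h4⟩, h5⟩ := mem_disjointSets.mp hs'
        refine mem_disjointSets.mpr ⟨⟨?_, by rw [Finset.card_insert_of_notMem hms, h4]⟩, ?_⟩
        · intro a ha
          rcases Finset.mem_insert.mp ha with rfl | ha
          · exact List.mem_cons_self
          · exact List.mem_cons_of_mem _ ((hmem a).mp (h3 a ha)).1
        · intro a ha b hb hab
          rcases Finset.mem_insert.mp ha with ha' | ha' <;>
            rcases Finset.mem_insert.mp hb with hb' | hb'
          · exact absurd (ha'.trans hb'.symm) hab
          · rw [ha', Nat.land_comm]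
            exact ((hmem b).mp (h3 b hb')).2
          · rw [hb']
            exact ((hmem a).mp (h3 a ha')).2
          · exact h5 a ha' b hb' hab
      · intro s hs
        obtain ⟨⟨h3, h4⟩, h5⟩ := mem_disjointSets.mp hs
        exact mem_disjointSets.mpr ⟨⟨fun a ha => List.mem_cons_of_mem _ (h3 a ha), h4⟩, h5⟩

/-- The bit masks of the affine planes in `V 4`. -/
def planeMasks : List ℕ :=
  (List.range 16).flatMap fun a => ((List.range 16).filter (Nat.blt a)).flatMap fun b =>
    (((List.range 16).filter (Nat.blt b)).filter fun c =>
      Nat.blt c (Nat.xor a (Nat.xor b c))).map fun c =>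
        2 ^ a + 2 ^ b + 2 ^ c + 2 ^ Nat.xor a (Nat.xor b c)

/-- The number with binary digits `x`. -/
def code (x : V 4) : ℕ := (x 0).val + 2 * (x 1).val + 4 * (x 2).val + 8 * (x 3).val

/-- The set of vectors with a given bit mask. -/
def decode (m : ℕ) : Finset (V 4) := Finset.univ.filter fun x => m.testBit (code x)

theorem isPlane_decode : ∀ m ∈ planeMasks, IsPlane (decode m) := by
  unfold IsPlane
  decide +kernel

theorem planeMasks_lt : ∀ m ∈ planeMasks, m < 2 ^ 16 := by decide +kernel

theorem planeMasks_nodup : planeMasks.Nodup := by decide +kernel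

theorem code_surjective : ∀ i : Fin 16, ∃ x, code x = i := by decide +kernel

/-- The constants are `s - 2r/3` for `n = 4` and `d = 2k`, exactly what the correction term
requires. -/
theorem disjointCount_values : 140 ≤ disjointCount 1 planeMasks ∧
    2730 ≤ disjointCount 2 planeMasks ∧ 6020 ≤ disjointCount 3 planeMasks ∧
    1505 ≤ disjointCount 4 planeMasks := by decide +kernel

theorem eq_of_decode_eq {m m' : ℕ} (hm : m < 2 ^ 16) (hm' : m' < 2 ^ 16)
    (h : decode m = decode m') : m = m' := by
  refine Nat.eq_of_testBit_eq fun i => ?_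
  rcases Nat.lt_or_ge i 16 with hi | hi
  · obtain ⟨x, hx⟩ := code_surjective ⟨i, hi⟩
    have h1 : x ∈ decode m ↔ x ∈ decode m' := by rw [h]
    simp only [decode, Finset.mem_filter, Finset.mem_univ, true_and, hx] at h1
    exact Bool.eq_iff_iff.mpr h1
  · have h2 : 2 ^ 16 ≤ 2 ^ i := Nat.pow_le_pow_right (by simp) hi
    rw [Nat.testBit_eq_false_of_lt (hm.trans_le h2), Nat.testBit_eq_false_of_lt (hm'.trans_le h2)]

theorem disjoint_decode {m m' : ℕ} (h : m &&& m' = 0) : Disjoint (decode m) (decode m') := by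
  rw [Finset.disjoint_left]
  intro x hx hx'
  simp only [decode, Finset.mem_filter, Finset.mem_univ, true_and] at hx hx'
  have := Nat.testBit_land m m' (code x)
  rw [h, hx, hx', Nat.zero_testBit] at this
  simp at this

theorem card_disjointSets_le (k : ℕ) :
    (disjointSets k planeMasks).card ≤ Fintype.card (PlaneSet k) := by
  have hinj {s : Finset ℕ} (hs : ∀ a ∈ s, a ∈ planeMasks) : Set.InjOn decode s :=
    fun a ha b hb h => eq_of_decode_eq (planeMasks_lt a (hs a ha)) (planeMasks_lt b (hs b hb)) h
  let g : disjointSets k planeMasks → PlaneSet k := fun s => ⟨s.1.image decode, by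
    obtain ⟨⟨h1, h2⟩, h3⟩ := mem_disjointSets.mp s.2
    refine ⟨by rw [Finset.card_image_of_injOn (hinj h1), h2], ?_, ?_⟩
    · intro p hp
      obtain ⟨a, ha, rfl⟩ := Finset.mem_image.mp hp
      exact isPlane_decode a (h1 a ha)
    · intro p hp q hq hpq
      obtain ⟨a, ha, rfl⟩ := Finset.mem_image.mp (Finset.mem_coe.mp hp)
      obtain ⟨b, hb, rfl⟩ := Finset.mem_image.mp (Finset.mem_coe.mp hq)
      exact disjoint_decode (h3 a ha b hb fun h => hpq (h ▸ rfl))⟩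
  have hg : Function.Injective g := by
    rintro ⟨s, hs⟩ ⟨t, ht⟩ h
    have h' : s.image decode = t.image decode := congrArg Subtype.val h
    have hs := (mem_disjointSets.mp hs).1.1
    have ht := (mem_disjointSets.mp ht).1.1
    have key {s t : Finset ℕ} (hs : ∀ a ∈ s, a ∈ planeMasks) (ht : ∀ a ∈ t, a ∈ planeMasks)
        (h : s.image decode = t.image decode) : s ⊆ t := by
      intro a ha
      obtain ⟨b, hb, hab⟩ := Finset.mem_image.mp (h ▸ Finset.mem_image_of_mem decode ha)
      rwa [← eq_of_decode_eq (planeMasks_lt b (ht b hb)) (planeMasks_lt a (hs a ha)) hab]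
    exact Subtype.ext ((key hs ht h').antisymm (key ht hs h'.symm))
  simpa using Fintype.card_le_of_injective g hg

theorem disjointCount_le_card_planeSet (k : ℕ) :
    disjointCount k planeMasks ≤ Fintype.card (PlaneSet k) :=
  (disjointCount_le k _ planeMasks_nodup).trans (card_disjointSets_le k)


/-! ### Numerical bounds and their sum. -/

theorem aqBound_values :
    aqBound 4 2 = 19688967603486720000 ∧
    aqBound 4 3 = 128873242495549440000 ∧
    aqBound 4 4 = 147726920564342784000 ∧
    aqBound 4 5 = 180013418089021440000 ∧
    aqBound 4 6 = 215767598335053004800 ∧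
    aqBound 4 7 = 288956603581857792000 ∧
    aqBound 4 8 = 577596589046602137600 := by
  refine ⟨?_, ?_, ?_, ?_, ?_, ?_, ?_⟩ <;>
  norm_num [aqBound, deltaNum, sNum, rNum, Finset.sum_range_succ, Nat.factorial, Nat.choose,
    Nat.even_iff]

theorem card_nonInv_bound (d : ℕ) (hd : d ≠ 0) :
    numDerangements d * (2 ^ (d / 2) * (d / 2).factorial)
      ≤ Fintype.card (NonInv (Fin d)) * (2 ^ (d / 2) * (d / 2).factorial)
        + if Even d then d.factorial else 0 := by
  have : Nonempty (Fin d) := ⟨⟨0, Nat.pos_of_ne_zero hd⟩⟩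
  have h1 := numDerangements_le (X := Fin d)
  have h2 := card_involution_mul_le (X := Fin d)
  rw [Fintype.card_fin] at h1 h2
  refine (Nat.mul_le_mul_right _ h1).trans ?_
  rw [add_mul]
  refine Nat.add_le_add (le_of_eq ?_) h2
  congr!

/-- Multiplying by `2^(d/2) (d/2)!` keeps the subtraction of the involutions free of division. -/
theorem le_card_nonInv {d m : ℕ} (hd : d ≠ 0)
    (h : m * (2 ^ (d / 2) * (d / 2).factorial) + (if Even d then d.factorial else 0)
      ≤ numDerangements d * (2 ^ (d / 2) * (d / 2).factorial)) :
    m ≤ Fintype.card (NonInv (Fin d)) :=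
  Nat.le_of_mul_le_mul_right
    (Nat.le_of_add_le_add_right (h.trans (card_nonInv_bound d hd))) (by positivity)

theorem le_card_pairedDatum {d m : ℕ} (hm : m ≤ Fintype.card (NonInv (Fin d))) :
    (15 * Nat.choose 8 d) ^ 2 * (d.factorial * m * 2 ^ (4 * d)) ≤ Fintype.card (PairedDatum d) := by
  rw [card_pairedDatum]
  gcongr

theorem aqBound_le_of_pairedDatum {d m N : ℕ} (hm : m ≤ Fintype.card (NonInv (Fin d)))
    (hN : N ≤ (15 * Nat.choose 8 d) ^ 2 * (d.factorial * m * 2 ^ (4 * d)) *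
      ((16 - 2 * d).factorial * 2 ^ (16 - 2 * d))) (h : aqBound 4 d = (N : ℚ)) :
    aqBound 4 d ≤ ((bentSquaresAQCount 4 (2 * d)).ncard : ℚ) := by
  rw [h, Nat.cast_le]
  exact hN.trans ((Nat.mul_le_mul_right _ (le_card_pairedDatum hm)).trans
    (card_pairedDatum_mul_le d))

theorem aqBound_le_of_planeDatum {d k m A N : ℕ} (hd : d = 2 * k)
    (hm : m ≤ Fintype.card (NonInv (Fin d))) (hA : A ≤ disjointCount k planeMasks)
    (hN : N ≤ ((15 * Nat.choose 8 d) ^ 2 * (d.factorial * m * 2 ^ (4 * d))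
      + A ^ 2 * (k.factorial * 512 ^ k)) * ((16 - 2 * d).factorial * 2 ^ (16 - 2 * d)))
    (h : aqBound 4 d = (N : ℚ)) :
    aqBound 4 d ≤ ((bentSquaresAQCount 4 (2 * d)).ncard : ℚ) := by
  rw [h, Nat.cast_le]
  have hA := hA.trans (disjointCount_le_card_planeSet k)
  exact hN.trans ((Nat.mul_le_mul_right _ (Nat.add_le_add (le_card_pairedDatum hm)
    ((Nat.mul_le_mul_right _ (Nat.pow_le_pow_left hA 2)).trans (le_card_planeDatum k)))).trans
    (card_add_card_mul_le hd))

/-- Here and for the other `d`, `m` is the number of derangements, for even `d` reduced by the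
`(d-1)!!` fixed-point-free involutions. At `d = 2` nothing remains and the plane cores supply the
whole bound. -/
theorem aqBound_2_le : aqBound 4 2 ≤ ((bentSquaresAQCount 4 (2 * 2)).ncard : ℚ) :=
  aqBound_le_of_planeDatum (k := 1) (N := 19688967603486720000) rfl
    (le_card_nonInv (m := 0) (by simp) (by decide)) disjointCount_values.1
    (by norm_num [Nat.factorial, Nat.choose]) (by simp [aqBound_values])

theorem aqBound_3_le : aqBound 4 3 ≤ ((bentSquaresAQCount 4 (2 * 3)).ncard : ℚ) :=
  aqBound_le_of_pairedDatum (N := 128873242495549440000)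
    (le_card_nonInv (m := 2) (by simp) (by decide))
    (by norm_num [Nat.factorial, Nat.choose]) (by simp [aqBound_values])

theorem aqBound_4_le : aqBound 4 4 ≤ ((bentSquaresAQCount 4 (2 * 4)).ncard : ℚ) :=
  aqBound_le_of_planeDatum (k := 2) (N := 147726920564342784000) rfl
    (le_card_nonInv (m := 6) (by simp) (by decide)) disjointCount_values.2.1
    (by norm_num [Nat.factorial, Nat.choose]) (by simp [aqBound_values])

theorem aqBound_5_le : aqBound 4 5 ≤ ((bentSquaresAQCount 4 (2 * 5)).ncard : ℚ) :=
  aqBound_le_of_pairedDatum (N := 180013418089021440000)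
    (le_card_nonInv (m := 44) (by simp) (by decide))
    (by norm_num [Nat.factorial, Nat.choose]) (by simp [aqBound_values])

theorem aqBound_6_le : aqBound 4 6 ≤ ((bentSquaresAQCount 4 (2 * 6)).ncard : ℚ) :=
  aqBound_le_of_planeDatum (k := 3) (N := 215767598335053004800) rfl
    (le_card_nonInv (m := 250) (by simp) (by decide)) disjointCount_values.2.2.1
    (by norm_num [Nat.factorial, Nat.choose]) (by simp [aqBound_values])

theorem aqBound_7_le : aqBound 4 7 ≤ ((bentSquaresAQCount 4 (2 * 7)).ncard : ℚ) :=
  aqBound_le_of_pairedDatum (N := 288956603581857792000)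
    (le_card_nonInv (m := 1854) (by simp) (by decide))
    (by norm_num [Nat.factorial, Nat.choose]) (by simp [aqBound_values])

theorem aqBound_8_le : aqBound 4 8 ≤ ((bentSquaresAQCount 4 (2 * 8)).ncard : ℚ) :=
  aqBound_le_of_planeDatum (k := 4) (N := 577596589046602137600) rfl
    (le_card_nonInv (m := 14728) (by simp) (by decide)) disjointCount_values.2.2.2
    (by norm_num [Nat.factorial, Nat.choose]) (by simp [aqBound_values])

theorem aqBound_le (d : ℕ) (hd : d ∈ Finset.Icc 2 8) :
    aqBound 4 d ≤ ((bentSquaresAQCount 4 (2 * d)).ncard : ℚ) := by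
  obtain ⟨h1, h2⟩ := Finset.mem_Icc.mp hd
  interval_cases d
  exacts [aqBound_2_le, aqBound_3_le, aqBound_4_le, aqBound_5_le, aqBound_6_le, aqBound_7_le,
    aqBound_8_le]

theorem sum_aqBound :
    (2 ^ 2 ^ 4 * Nat.factorial (2 ^ 4) : ℚ) + ∑ d ∈ Finset.Icc 2 8, aqBound 4 d
      = 1559994535674013286400 := by
  rw [show Finset.Icc 2 8 = {2, 3, 4, 5, 6, 7, 8} by decide]
  norm_num [aqBound_values, Nat.factorial]

theorem le_ncard_add_sum :
    1559994535674013286400 ≤ (bentSquaresA 4).ncard +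
      ∑ d ∈ Finset.Icc 2 8, (bentSquaresAQCount 4 (2 * d)).ncard := by
  have h := Finset.sum_le_sum aqBound_le
  have h2 : (1559994535674013286400 : ℚ) ≤ ((bentSquaresA 4).ncard : ℚ) +
      ∑ d ∈ Finset.Icc 2 8, ((bentSquaresAQCount 4 (2 * d)).ncard : ℚ) := by
    rw [← sum_aqBound, ncard_bentSquaresA]
    push_cast
    exact add_le_add_right h _
  exact_mod_cast h2

set_option exponentiation.threshold 2000 in
theorem abs_logb_sub_lt : |Real.logb 2 1559994535674013286400 - 70.4| < 0.05 := by
  rw [abs_lt]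
  have h1 : (70.35 : ℝ) < Real.logb 2 1559994535674013286400 := by
    rw [Real.lt_logb_iff_rpow_lt (by norm_num) (by norm_num)]
    -- The twentieth power makes the exponent an integer, `20 · 70.35 = 1407`, so only integers need
    -- to be compared; the upper bound likewise uses `20 · 70.45 = 1409`.
    refine lt_of_pow_lt_pow_left₀ 20 (by norm_num) ?_
    rw [← Real.rpow_natCast, ← Real.rpow_mul (by norm_num),
      show (70.35 * (20 : ℕ) : ℝ) = (1407 : ℕ) by norm_num, Real.rpow_natCast]
    norm_num
  have h2 : Real.logb 2 1559994535674013286400 < (70.45 : ℝ) := by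
    rw [Real.logb_lt_iff_lt_rpow (by norm_num) (by norm_num)]
    refine lt_of_pow_lt_pow_left₀ 20 (by positivity) ?_
    rw [← Real.rpow_natCast ((2 : ℝ) ^ _), ← Real.rpow_mul (by norm_num),
      show (70.45 * (20 : ℕ) : ℝ) = (1409 : ℕ) by norm_num, Real.rpow_natCast]
    norm_num
  constructor <;> linarith

end BentSquares

theorem mainTheorem3 :
    (BentSquares.bentFunctions 4).ncard = (BentSquares.bentSquares 4).ncard ∧
    (BentSquares.bentSquaresA 4).ncard = 2 ^ 2 ^ 4 * Nat.factorial (2 ^ 4) ∧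
    (∀ d ∈ Finset.Icc 2 8,
      BentSquares.aqBound 4 d ≤ ((BentSquares.bentSquaresAQCount 4 (2 * d)).ncard : ℚ)) ∧
    (2 ^ 2 ^ 4 * Nat.factorial (2 ^ 4) : ℚ) + ∑ d ∈ Finset.Icc 2 8, BentSquares.aqBound 4 d
      = 1559994535674013286400 ∧
    (BentSquares.bentSquaresA 4).ncard +
        ∑ d ∈ Finset.Icc 2 8, (BentSquares.bentSquaresAQCount 4 (2 * d)).ncard
      ≤ (BentSquares.bentSquares 4).ncard ∧
    1559994535674013286400 ≤ (BentSquares.bentSquaresA 4).ncard +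
        ∑ d ∈ Finset.Icc 2 8, (BentSquares.bentSquaresAQCount 4 (2 * d)).ncard ∧
    1559994535674013286400 ≤ (BentSquares.bentFunctions 4).ncard ∧
    |Real.logb 2 1559994535674013286400 - 70.4| < 0.05 := by
  have hle := BentSquares.ncard_add_sum_le_ncard_bentSquares 4 (Finset.Icc 2 8) (by simp)
  exact ⟨BentSquares.ncard_bentFunctions 4, BentSquares.ncard_bentSquaresA 4,
    BentSquares.aqBound_le, BentSquares.sum_aqBound, hle, BentSquares.le_ncard_add_sum,
    (BentSquares.le_ncard_add_sum.trans hle).trans_eq (BentSquares.ncard_bentFunctions 4).symm,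
    BentSquares.abs_logb_sub_lt⟩
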